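/- A UAV hovers at altitude $h>0$ above the origin of the plane and transmits with power $P_u>0$. Device-to-device (D2D) transmitters, each of power $P_d>0$, form a homogeneous Poisson point process in the whole plane with density $\lambda_d>0$. For a downlink user at the point with polar coordinates $(r,\varphi)$, let $d_i$ be its distance to the $i$-th D2D transmitter and $g_i$ the corresponding channel gain; the $g_i$ are independent exponential variables of mean $1$, independent of the transmitter positions. The interference is $I_d=\sum_i P_d d_i^{-\alpha_d} g_i$ with $\alpha_d>2$. Put $|X_u|=\sqrt{h^2+r^2}$. Independently of the positions and gains, the link from the UAV to the user is line-of-sight (LoS) with probability $$P_{\rm LoS}(r)=\frac{1}{1+C\exp(-B[\theta-C])},\qquad \theta=\frac{180}{\pi}\arcsin\frac{h}{|X_u|},$$ where $B\in\mathbb R$ and $C\ge 0$ are constants, and non-line-of-sight (NLoS) with probability $P_{\rm NLoS}(r)=1-P_{\rm LoS}(r)$. The received power $P_{r,u}$ is $P_u|X_u|^{-\alpha_u}$ in the LoS case and $\eta P_u|X_u|^{-\alpha_u}$ in the NLoS case, where $\alpha_u,\eta>0$. Let $N\ge 0$ be the noise power, $\gamma_u=P_{r,u}/(I_d+N)$ the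 SINR, $\beta>0$ a threshold, and $P_{\rm cov,du}(r,\varphi,\beta)=\mathbb P[\gamma_u\ge\beta]$ the coverage probability. Its average over the disk of radius $R_c>0$ is $$\bar P_{\rm cov,du}(\beta)=\int_0^{R_c}\!\int_0^{2\pi}P_{\rm cov,du}(r,\varphi,\beta)\,\frac{r}{\pi R_c^2}\,d\varphi\,dr .$$ For $T>0$ let $$U_I(T)=\exp\Big(-\pi\lambda_d\Big(\frac{T}{P_d}\Big)^{-2/\alpha_d}\Gamma\Big(1+\frac{2}{\alpha_d}\Big)\Big),$$ $$L_I(T)=\Big(1-\frac{2\pi\lambda_d\,\Gamma(1+2/\alpha_d)}{\alpha_d-2}\Big(\frac{T}{P_d}\Big)^{-2/\alpha_d}\Big)U_I(T),$$ and let $U_I(T)=L_I(T)=0$ for $T\le 0$. Then $L_I(T)\le\mathbb P[I_d\le T]\le U_I(T)$ for every $T>0$ and every user location, and $$\bar P^{L}\le \bar P_{\rm cov,du}(\beta)\le \bar P^{U},$$ where $\bar P^{L}$ and $\bar P^{U}$ are given, with $F=L_I$ and $F=U_I$ respectively, by $$\int_0^{R_c}P_{\rm LoS}(r)\,F\Big(\frac{P_u|X_u|^{-\alpha_u}}{\beta}-N\Big)\frac{2r}{R_c^2}\,dr+\int_0^{R_c}P_{\rm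 NLoS}(r)\,F\Big(\frac{\eta P_u|X_u|^{-\alpha_u}}{\beta}-N\Big)\frac{2r}{R_c^2}\,dr ,$$ and all of these integrals converge. -/

import Mathlib

open MeasureTheory ProbabilityTheory Set

namespace UAV

noncomputable section

/-- The ground plane, with its Euclidean distance and Lebesgue (area) measure. -/
abbrev Plane : Type := EuclideanSpace ℝ (Fin 2)

/-- The point of the ground plane with polar coordinates `(r, φ)`. -/
def polarPoint (r φ : ℝ) : Plane := !₂[r * Real.cos φ, r * Real.sin φ]

/-- A sequence of random points `X 0, X 1, …` of the plane enumerates a homogeneous Poisson point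
process of intensity `lam`: the number of points in a measurable set of finite area is Poisson
distributed with mean `lam` times the area, and the numbers of points in finitely many pairwise
disjoint measurable sets of finite area are independent. -/
structure IsPoissonPointProcess {Ω : Type*} [MeasurableSpace Ω] (μ : Measure Ω) (lam : ℝ)
    (X : ℕ → Ω → Plane) : Prop where
  measurable : ∀ i, Measurable (X i)
  count_law : ∀ A : Set Plane, MeasurableSet A → volume A ≠ ⊤ →
    HasLaw (fun ω => {i | X i ω ∈ A}.encard)
      ((poissonMeasure (Real.toNNReal (lam * volume.real A))).map (Nat.cast : ℕ → ℕ∞)) μ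
  count_indep : ∀ (n : ℕ) (A : Fin n → Set Plane), (∀ k, MeasurableSet (A k)) →
    (∀ k, volume (A k) ≠ ⊤) → Pairwise (fun k l => Disjoint (A k) (A l)) →
    iIndepFun (fun k ω => {i | X i ω ∈ A k}.encard) μ

/-- The numerical parameters of the network. -/
structure Params where
  /-- transmit power of the UAV -/
  Pu : ℝ
  /-- path loss exponent of the link between the UAV and a user -/
  αu : ℝ
  /-- additional attenuation factor of a link without line of sight -/
  η : ℝ
  /-- altitude of the UAV, which hovers above the origin -/
  h : ℝ
  /-- environment constant of the line-of-sight probability -/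
  B : ℝ
  /-- environment constant of the line-of-sight probability -/
  C : ℝ
  /-- transmit power of a D2D transmitter -/
  Pd : ℝ
  /-- path loss exponent of the D2D signals -/
  αd : ℝ
  /-- density of the D2D transmitters -/
  lam : ℝ
  /-- noise power -/
  N : ℝ

namespace Params

variable (p : Params)

/-- Distance between the UAV and a ground user at distance `r` from the origin. -/
def distUAV (r : ℝ) : ℝ := Real.sqrt (p.h ^ 2 + r ^ 2)

/-- Elevation angle, in degrees. -/
def elevation (r : ℝ) : ℝ := 180 / Real.pi * Real.arcsin (p.h / p.distUAV r)

/-- Line-of-sight probability. -/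
def pLoS (r : ℝ) : ℝ := 1 / (1 + p.C * Real.exp (-p.B * (p.elevation r - p.C)))

/-- Probability of a link without line of sight. -/
def pNLoS (r : ℝ) : ℝ := 1 - p.pLoS r

/-- Power received from the UAV over a line-of-sight link. -/
def powerLoS (r : ℝ) : ℝ := p.Pu * p.distUAV r ^ (-p.αu)

/-- Power received from the UAV over a link without line of sight. -/
def powerNLoS (r : ℝ) : ℝ := p.η * p.Pu * p.distUAV r ^ (-p.αu)

/-- The upper bound `U_I(T)` on the distribution function of the interference. It is given by the
exponential formula for `T > 0` and extended by `0` to `T ≤ 0`. -/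
def upperCDF (T : ℝ) : ℝ :=
  if 0 < T then
    Real.exp (-(Real.pi * p.lam * (T / p.Pd) ^ (-2 / p.αd) * Real.Gamma (1 + 2 / p.αd)))
  else 0

/-- The lower bound `L_I(T)` on the distribution function of the interference. It is given by the
formula for `T > 0` and extended by `0` to `T ≤ 0`. -/
def lowerCDF (T : ℝ) : ℝ :=
  if 0 < T then
    (1 - 2 * Real.pi * p.lam * Real.Gamma (1 + 2 / p.αd) / (p.αd - 2)
          * (T / p.Pd) ^ (-2 / p.αd))
      * Real.exp (-(Real.pi * p.lam * (T / p.Pd) ^ (-2 / p.αd) * Real.Gamma (1 + 2 / p.αd)))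
  else 0

/-- The line-of-sight part of the integrand of the coverage bound built from `F`. -/
def integrandLoS (β Rc : ℝ) (F : ℝ → ℝ) (r : ℝ) : ℝ :=
  p.pLoS r * F (p.powerLoS r / β - p.N) * (2 * r / Rc ^ 2)

/-- The non-line-of-sight part of the integrand of the coverage bound built from `F`. -/
def integrandNLoS (β Rc : ℝ) (F : ℝ → ℝ) (r : ℝ) : ℝ :=
  p.pNLoS r * F (p.powerNLoS r / β - p.N) * (2 * r / Rc ^ 2)

/-- The coverage bound built from `F` (either `lowerCDF` or `upperCDF`). -/
def coverageBound (β Rc : ℝ) (F : ℝ → ℝ) : ℝ :=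
  (∫ r in (0 : ℝ)..Rc, p.integrandLoS β Rc F r) + ∫ r in (0 : ℝ)..Rc, p.integrandNLoS β Rc F r

end Params

/-- The random network as seen by a downlink user at any location `y` of the plane: the D2D
transmitters form a Poisson point process in the whole plane, the channel gains from the
transmitters to `y` are independent and exponentially distributed with mean one (Rayleigh fading)
and independent of the positions, and the link from the UAV to `y` has line of sight with
probability `pLoS`, independently of the positions and the gains. Nothing is required of the joint
law of the gains and link states at different locations. -/
structure Network {Ω : Type*} [MeasurableSpace Ω] (μ : Measure Ω) (p : Params) where
  /-- positions of the D2D transmitters -/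
  X : ℕ → Ω → Plane
  /-- `g y i` is the channel gain from the `i`-th D2D transmitter to the location `y` -/
  g : Plane → ℕ → Ω → ℝ
  /-- `los y ω = true` if the link from the UAV to the location `y` has line of sight -/
  los : Plane → Ω → Bool
  poisson : IsPoissonPointProcess μ p.lam X
  measurable_g : ∀ y i, Measurable (g y i)
  law_g : ∀ y i, HasLaw (g y i) (expMeasure 1) μ
  indep_g : ∀ y, iIndepFun (g y) μ
  indep_X_g : ∀ y, IndepFun (fun ω i => X i ω) (fun ω i => g y i ω) μ
  measurable_los : ∀ y, Measurable (los y)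
  prob_los : ∀ y, μ.real {ω | los y ω = true} = p.pLoS ‖y‖
  indep_los : ∀ y, IndepFun (los y) (fun ω => ((fun i => X i ω), (fun i => g y i ω))) μ

namespace Network

variable {Ω : Type*} [MeasurableSpace Ω] {μ : Measure Ω} {p : Params} (S : Network μ p)

/-- Total interference power `∑ i, P_d d_i ^ (-α_d) g_i` at the location `y`, as an element of
`[0, ∞]`, where `d_i` is the distance from `y` to the `i`-th D2D transmitter. -/
def interference (y : Plane) (ω : Ω) : ENNReal :=
  ∑' i, ENNReal.ofReal p.Pd * edist y (S.X i ω) ^ (-p.αd) * ENNReal.ofReal (S.g y i ω)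

/-- Power received at the location `y` from the UAV. -/
def received (y : Plane) (ω : Ω) : ℝ :=
  if S.los y ω = true then p.powerLoS ‖y‖ else p.powerNLoS ‖y‖

/-- Signal to interference plus noise ratio of a downlink user at the location `y`. -/
def sinr (y : Plane) (ω : Ω) : ENNReal :=
  ENNReal.ofReal (S.received y ω) / (S.interference y ω + ENNReal.ofReal p.N)

/-- Coverage probability of a downlink user with polar coordinates `(r, φ)`, for the SINR
threshold `β`. -/
def coverage (β r φ : ℝ) : ℝ :=
  μ.real {ω | ENNReal.ofReal β ≤ S.sinr (polarPoint r φ) ω}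

/-- Density, in polar coordinates, of the uniform distribution on the disk of radius `Rc`. -/
def userDensity (Rc r : ℝ) : ℝ := r / (Real.pi * Rc ^ 2)

/-- Coverage probability of a downlink user averaged over the disk of radius `Rc`. -/
def averageCoverage (β Rc : ℝ) : ℝ :=
  ∫ z in Icc (0 : ℝ) Rc ×ˢ Icc (0 : ℝ) (2 * Real.pi), S.coverage β z.1 z.2 * userDensity Rc z.1

end Network

end

end UAV

/-!
The powers received at a location `y` from the individual transmitters form a Poisson process on
`(0, ∞]`, and everything follows from its Laplace functional. For a homogeneous Poisson process of
points, `𝔼 exp (-∑ f (X i)) = exp (-λ ∫ (1 - e^{-f}))`: for simple `f` this is the independence and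
the Poisson law of the counts, and monotone limits give the rest. Integrating out the gains turns
this into the Laplace functional of the received powers, whose intensity measure `λ ρ` has tail
`ρ (T, ∞] = π (T / P_d) ^ (-2 / α_d) Γ (1 + 2 / α_d)`.

*Upper bound.* If `I ≤ T` then no single power exceeds `T`, an event `E` whose probability
`exp (-λ ρ (T, ∞])` is `U_I(T)`.

*Lower bound.* On `E` the interference is a sum over a Poisson process of powers at most `T`, so its
conditional mean is `λ ∫_{a ≤ T} a dρ = T · (2 / (α_d - 2)) · λ ρ (T, ∞]` by the layer cake formula,
and Markov's inequality bounds the probability of `E ∩ {I > T}` by `2 / (α_d - 2) · λ ρ (T, ∞]` times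
`U_I(T)`. To use nothing but the Laplace functional, Markov's inequality is applied to
`1 - e^{-t I}`, and then `t → 0`.

*Coverage.* Since `ρ` is the same at all locations, so is the law of the interference, although the
gains at different locations are unrelated; this follows from the Laplace transform, whose values at
the naturals are the moments of the `[0, 1]`-valued variable `e^{-I}`. Conditioning on the link state
shows that the average coverage probability is exactly the coverage bound built from the
distribution function `G` of the interference, which in particular makes the coverage probability
measurable in the location. As `L_I ≤ G ≤ U_I`, monotonicity of the integrals concludes.
-/

namespace UAV

open Filter Topology
open scoped ENNReal NNReal

/-! ### The function `e^{-x}` on `[0, ∞]` -/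

/-- The function `x ↦ e^{-x}` on `[0, ∞]`, with `e^{-∞} = 0`. -/
noncomputable def expNeg (x : ℝ≥0∞) : ℝ≥0∞ := (EReal.exp x)⁻¹

lemma expNeg_eq_exp_neg (x : ℝ≥0∞) : expNeg x = EReal.exp (-(x : EReal)) :=
  (EReal.exp_neg _).symm

@[simp] lemma expNeg_zero : expNeg 0 = 1 := by simp [expNeg]

@[simp] lemma expNeg_top : expNeg ⊤ = 0 := by simp [expNeg]

lemma expNeg_ofReal {x : ℝ} (hx : 0 ≤ x) :
    expNeg (ENNReal.ofReal x) = ENNReal.ofReal (Real.exp (-x)) := by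
  rw [expNeg_eq_exp_neg, EReal.coe_ennreal_ofReal, max_eq_left hx, ← EReal.coe_neg, EReal.exp_coe]

lemma expNeg_add (x y : ℝ≥0∞) : expNeg (x + y) = expNeg x * expNeg y := by
  rw [expNeg_eq_exp_neg, expNeg_eq_exp_neg, expNeg_eq_exp_neg, EReal.coe_ennreal_add,
    EReal.neg_add (by simp) (by simp), sub_eq_add_neg, EReal.exp_add]

lemma expNeg_sum {ι : Type*} (s : Finset ι) (f : ι → ℝ≥0∞) :
    expNeg (∑ i ∈ s, f i) = ∏ i ∈ s, expNeg (f i) := by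
  classical
  induction s using Finset.induction_on with
  | empty => simp
  | insert a s ha ih => rw [Finset.sum_insert ha, Finset.prod_insert ha, expNeg_add, ih]

lemma expNeg_mul_natCast (x : ℝ≥0∞) (n : ℕ) : expNeg (x * n) = expNeg x ^ n := by
  induction n with
  | zero => simp
  | succ n ih => rw [Nat.cast_succ, mul_add, mul_one, expNeg_add, ih, pow_succ]

lemma expNeg_le_expNeg_iff {x y : ℝ≥0∞} : expNeg x ≤ expNeg y ↔ y ≤ x := by
  rw [expNeg_eq_exp_neg, expNeg_eq_exp_neg, EReal.exp_le_exp_iff, EReal.neg_le_neg_iff,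
    EReal.coe_ennreal_le_coe_ennreal_iff]

lemma antitone_expNeg : Antitone expNeg := fun _ _ hxy => expNeg_le_expNeg_iff.2 hxy

lemma expNeg_le_one (x : ℝ≥0∞) : expNeg x ≤ 1 := expNeg_zero ▸ antitone_expNeg zero_le

lemma continuous_expNeg : Continuous expNeg := by
  have : expNeg = fun x : ℝ≥0∞ => (EReal.exp x)⁻¹ := rfl
  rw [this]
  exact continuous_inv.comp (ENNReal.continuous_exp.comp continuous_coe_ennreal_ereal)

@[fun_prop] lemma measurable_expNeg : Measurable expNeg := continuous_expNeg.measurable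

/-- `e^{-·}` maps `[0, ∞]` onto `[0, 1]`. -/
lemma expNeg_neg_log {x : ℝ≥0∞} (hx : x ≤ 1) : expNeg (-ENNReal.log x).toENNReal = x := by
  rw [expNeg_eq_exp_neg, EReal.coe_toENNReal, neg_neg, ENNReal.exp_log]
  have : ENNReal.log x ≤ 0 := by simpa using hx
  simpa using this

/-! ### Laplace functionals of Poisson point processes -/

lemma lintegral_expNeg_poisson (m : ℝ≥0) (c : ℝ≥0∞) :
    ∫⁻ n, expNeg (c * n) ∂(poissonMeasure m) = expNeg (m * (1 - expNeg c)) := by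
  have hc : expNeg c ≠ ⊤ := ((expNeg_le_one c).trans_lt ENNReal.one_lt_top).ne
  obtain ⟨u, hu⟩ : ∃ u : ℝ≥0, expNeg c = u := ⟨_, (ENNReal.coe_toNNReal hc).symm⟩
  have hu1 : (u : ℝ) ≤ 1 := by
    have := expNeg_le_one c
    rw [hu] at this
    exact_mod_cast this
  have hsum : HasSum (fun n : ℕ => (u : ℝ) ^ n * (Real.exp (-m) * (m : ℝ) ^ n / n.factorial))
      (Real.exp (-(m * (1 - u)))) := by
    have h := (NormedSpace.expSeries_div_hasSum_exp (𝔸 := ℝ) ((u : ℝ) * m)).mul_left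
      (Real.exp (-(m : ℝ)))
    rw [← Real.exp_eq_exp_ℝ, ← Real.exp_add] at h
    have e : -(m : ℝ) + u * m = -(m * (1 - u)) := by ring
    rw [e] at h
    refine h.congr_fun fun n => ?_
    rw [mul_pow]
    ring
  rw [lintegral_countable']
  have hm : (m : ℝ≥0∞) * (1 - expNeg c) = ENNReal.ofReal (m * (1 - u)) := by
    rw [hu, ENNReal.ofReal_mul m.coe_nonneg, ENNReal.ofReal_sub _ u.coe_nonneg]; simp
  rw [hm, expNeg_ofReal (mul_nonneg m.coe_nonneg (by linarith)), ← hsum.tsum_eq,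
    ENNReal.ofReal_tsum_of_nonneg (fun n => by positivity) hsum.summable]
  refine tsum_congr fun n => ?_
  rw [expNeg_mul_natCast, hu, poissonMeasure_singleton, ENNReal.ofReal_mul (by positivity),
    ENNReal.ofReal_pow u.coe_nonneg, ENNReal.ofReal_coe_nnreal]

lemma tsum_indicator_eq_encard {α : Type*} (x : ℕ → α) (A : Set α) :
    ∑' i, A.indicator (fun _ => (1 : ℝ≥0∞)) (x i) = ({i | x i ∈ A}.encard : ℝ≥0∞) := by
  rw [← ENNReal.tsum_set_one, tsum_subtype {i | x i ∈ A} (fun _ => (1 : ℝ≥0∞))]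
  rfl

section Poisson

variable {Ω : Type*} [MeasurableSpace Ω] {μ : Measure Ω} {lam : ℝ} {X : ℕ → Ω → Plane}

lemma IsPoissonPointProcess.measurable_count (hX : IsPoissonPointProcess μ lam X) {A : Set Plane}
    (hA : MeasurableSet A) : Measurable fun ω => ({i | X i ω ∈ A}.encard : ℝ≥0∞) := by
  simp_rw [← tsum_indicator_eq_encard (fun i => X i _) A]
  exact Measurable.tsum fun i => (measurable_const.indicator hA).comp (hX.measurable i)

lemma IsPoissonPointProcess.lintegral_expNeg_count (hX : IsPoissonPointProcess μ lam X)
    (hlam : 0 ≤ lam) {A : Set Plane} (hA : MeasurableSet A) (hA' : volume A ≠ ⊤) (c : ℝ≥0∞) :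
    ∫⁻ ω, expNeg (c * ({i | X i ω ∈ A}.encard : ℝ≥0∞)) ∂μ =
      expNeg (ENNReal.ofReal lam * (volume A * (1 - expNeg c))) := by
  have hlaw := hX.count_law A hA hA'
  have hmeas : Measurable fun n : ℕ∞ => expNeg (c * (n : ℝ≥0∞)) := measurable_from_top
  calc ∫⁻ ω, expNeg (c * ({i | X i ω ∈ A}.encard : ℝ≥0∞)) ∂μ
      = ∫⁻ n : ℕ∞, expNeg (c * (n : ℝ≥0∞)) ∂(μ.map fun ω => {i | X i ω ∈ A}.encard) :=
        (lintegral_map' hmeas.aemeasurable hlaw.aemeasurable).symm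
    _ = ∫⁻ n : ℕ, expNeg (c * n) ∂(poissonMeasure (Real.toNNReal (lam * volume.real A))) := by
        rw [hlaw.map_eq, lintegral_map hmeas measurable_from_top]
        simp
    _ = _ := by
        rw [lintegral_expNeg_poisson, ← ENNReal.ofReal, ENNReal.ofReal_mul hlam, mul_assoc,
          ofReal_measureReal hA']

/-- The Laplace functional on simple functions: the counts of the level sets are independent
Poisson variables. -/
lemma IsPoissonPointProcess.lintegral_expNeg_simpleFunc (hX : IsPoissonPointProcess μ lam X)
    (hlam : 0 ≤ lam) (f : SimpleFunc Plane ℝ≥0∞) (hf : ∀ c ≠ 0, volume (f ⁻¹' {c}) ≠ ⊤) :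
    ∫⁻ ω, expNeg (∑' i, f (X i ω)) ∂μ =
      expNeg (ENNReal.ofReal lam * ∫⁻ x, (1 - expNeg (f x))) := by
  classical
  set s : Finset ℝ≥0∞ := f.range.filter (· ≠ 0) with hs
  have hf_eq : ∀ x, f x = ∑ c ∈ s, c * (f ⁻¹' {c}).indicator (fun _ => (1 : ℝ≥0∞)) x := by
    intro x
    by_cases h0 : f x = 0
    · rw [h0, eq_comm]
      refine Finset.sum_eq_zero fun c hc => ?_
      rw [indicator_of_notMem, mul_zero]
      simpa [h0] using (Finset.mem_filter.1 hc).2.symm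
    · rw [Finset.sum_eq_single (f x)]
      · simp
      · intro c _ hc
        rw [indicator_of_notMem, mul_zero]
        simpa using hc.symm
      · intro h
        exact absurd (Finset.mem_filter.2 ⟨f.mem_range_self x, h0⟩) h
  have hsum : ∀ ω, ∑' i, f (X i ω) = ∑ c ∈ s, c * ({i | X i ω ∈ f ⁻¹' {c}}.encard : ℝ≥0∞) := by
    intro ω
    simp_rw [hf_eq (X _ ω)]
    rw [Summable.tsum_finsetSum fun _ _ => ENNReal.summable]
    refine Finset.sum_congr rfl fun c _ => ?_
    rw [ENNReal.tsum_mul_left, tsum_indicator_eq_encard (fun i => X i ω)]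
  have hvol : ∀ c : s, volume (f ⁻¹' {c.1}) ≠ ⊤ := fun c => hf c (Finset.mem_filter.1 c.2).2
  have hind : iIndepFun (fun (c : s) ω => {i | X i ω ∈ f ⁻¹' {c.1}}.encard) μ := by
    have h := hX.count_indep s.card (fun k => f ⁻¹' {(s.equivFin.symm k).1})
      (fun k => f.measurableSet_fiber _) (fun k => hvol _) (by
        intro k l hkl
        refine Disjoint.preimage _ ?_
        rw [disjoint_singleton]
        exact fun h => hkl (s.equivFin.symm.injective (Subtype.ext h)))
    have h' := h.precomp s.equivFin.injective
    simpa [Function.comp_def] using h'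
  have hind' : iIndepFun
      (fun (c : s) ω => expNeg (c.1 * ({i | X i ω ∈ f ⁻¹' {c.1}}.encard : ℝ≥0∞))) μ :=
    hind.comp (fun c (n : ℕ∞) => expNeg (c.1 * (n : ℝ≥0∞))) fun _ => measurable_from_top
  have hint : ∫⁻ x, (1 - expNeg (f x)) = ∑ c ∈ s, volume (f ⁻¹' {c}) * (1 - expNeg c) := by
    have h := (f.map fun c => 1 - expNeg c).lintegral_eq_lintegral volume
    rw [SimpleFunc.map_lintegral] at h
    simp only [SimpleFunc.coe_map, Function.comp_apply] at h
    rw [h, hs, Finset.sum_filter]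
    refine Finset.sum_congr rfl fun c _ => ?_
    by_cases hc : c = 0
    · simp [hc]
    · rw [if_pos hc, mul_comm]
  simp_rw [hsum, expNeg_sum, hint, Finset.mul_sum, ← Finset.prod_coe_sort s]
  rw [lintegral_prod_eq_prod_lintegral_of_indepFun _ _ hind' fun c => measurable_expNeg.comp
    (measurable_const.mul (hX.measurable_count (f.measurableSet_fiber _)))]
  rw [expNeg_sum, ← Finset.prod_coe_sort s]
  exact Finset.prod_congr rfl fun c _ =>
    hX.lintegral_expNeg_count hlam (f.measurableSet_fiber _) (hvol c) _

/-- The Laplace functional of a homogeneous Poisson point process. -/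
theorem IsPoissonPointProcess.lintegral_expNeg_tsum [IsProbabilityMeasure μ]
    (hX : IsPoissonPointProcess μ lam X) (hlam : 0 ≤ lam) {f : Plane → ℝ≥0∞} (hf : Measurable f) :
    ∫⁻ ω, expNeg (∑' i, f (X i ω)) ∂μ =
      expNeg (ENNReal.ofReal lam * ∫⁻ x, (1 - expNeg (f x))) := by
  -- simple functions of bounded support increasing to `f`
  let F : ℕ → SimpleFunc Plane ℝ≥0∞ := fun n =>
    (SimpleFunc.eapprox f n).restrict (Metric.closedBall 0 n)
  have hF : ∀ n x, F n x = (Metric.closedBall (0 : Plane) n).indicator (SimpleFunc.eapprox f n) x :=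
    fun n x => by
      simp only [F]; rw [SimpleFunc.restrict_apply _ measurableSet_closedBall]
  have hmono : ∀ x, Monotone fun n => F n x := by
    intro x n m hnm
    simp only [hF]
    refine (indicator_le_indicator (SimpleFunc.monotone_eapprox f hnm x)).trans
      (indicator_le_indicator_of_subset (Metric.closedBall_subset_closedBall (by exact_mod_cast hnm))
        (fun _ => zero_le) x)
  have hlim : ∀ x, Tendsto (fun n => F n x) atTop (𝓝 (f x)) := by
    intro x
    refine (SimpleFunc.tendsto_eapprox hf x).congr' ?_
    filter_upwards [eventually_ge_atTop ⌈‖x‖⌉₊] with n hn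
    rw [hF, indicator_of_mem]
    simpa using Nat.ceil_le.1 hn
  have hvol : ∀ n, ∀ c ≠ 0, volume (F n ⁻¹' {c}) ≠ ⊤ := by
    intro n c hc
    refine ((measure_mono (t := Metric.closedBall (0 : Plane) n) fun x hx => ?_).trans_lt
      measure_closedBall_lt_top).ne
    by_contra hx'
    rw [mem_preimage, hF, indicator_of_notMem hx'] at hx
    exact hc hx.symm
  have htsum : ∀ ω, Tendsto (fun n => ∑' i, F n (X i ω)) atTop (𝓝 (∑' i, f (X i ω))) := by
    intro ω
    have h := lintegral_tendsto_of_tendsto_of_monotone (μ := Measure.count)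
      (f := fun n i => F n (X i ω)) (F := fun i => f (X i ω))
      (fun n => measurable_from_top.aemeasurable) (.of_forall fun i => hmono (X i ω))
      (.of_forall fun i => hlim (X i ω))
    simpa only [lintegral_count] using h
  have hL : Tendsto (fun n => ∫⁻ ω, expNeg (∑' i, F n (X i ω)) ∂μ) atTop
      (𝓝 (∫⁻ ω, expNeg (∑' i, f (X i ω)) ∂μ)) := by
    refine tendsto_lintegral_of_dominated_convergence (fun _ => 1) (fun n => ?_)
      (fun n => .of_forall fun ω => expNeg_le_one _) (by simp)
      (.of_forall fun ω => (continuous_expNeg.tendsto _).comp (htsum ω))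
    exact measurable_expNeg.comp
      (Measurable.tsum fun i => (F n).measurable.comp (hX.measurable i))
  have hR : Tendsto (fun n => expNeg (ENNReal.ofReal lam * ∫⁻ x, (1 - expNeg (F n x)))) atTop
      (𝓝 (expNeg (ENNReal.ofReal lam * ∫⁻ x, (1 - expNeg (f x))))) := by
    refine (continuous_expNeg.tendsto _).comp (ENNReal.Tendsto.const_mul ?_ (.inr (by simp)))
    refine lintegral_tendsto_of_tendsto_of_monotone
      (fun n => (measurable_const.sub (measurable_expNeg.comp (F n).measurable)).aemeasurable)
      (.of_forall fun x n m hnm => tsub_le_tsub_left (antitone_expNeg (hmono x hnm)) _)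
      (.of_forall fun x => ?_)
    exact ENNReal.Tendsto.sub tendsto_const_nhds ((continuous_expNeg.tendsto _).comp (hlim x))
      (.inl (by simp))
  simp_rw [hX.lintegral_expNeg_simpleFunc hlam _ (hvol _)] at hL
  exact tendsto_nhds_unique hL hR

/-- Integrating out independent marks, conditionally on the positions of finitely many points. -/
lemma lintegral_expNeg_sum_marked [IsProbabilityMeasure μ] (hX : ∀ i, Measurable (X i))
    {ν : Measure ℝ} {g : ℕ → Ω → ℝ} (hg : ∀ i, Measurable (g i))
    (hlaw : ∀ i, HasLaw (g i) ν μ) (hind : iIndepFun g μ)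
    (hXg : IndepFun (fun ω i => X i ω) (fun ω i => g i ω) μ)
    {H : Plane → ℝ → ℝ≥0∞} (hH : Measurable (Function.uncurry H)) (s : Finset ℕ) :
    ∫⁻ ω, expNeg (∑ i ∈ s, H (X i ω) (g i ω)) ∂μ =
      ∫⁻ ω, ∏ i ∈ s, ∫⁻ u, expNeg (H (X i ω) u) ∂ν ∂μ := by
  have hHx : ∀ x, Measurable fun u => expNeg (H x u) := fun x =>
    measurable_expNeg.comp hH.of_uncurry_left
  have hν : SFinite ν := by
    have := Measure.isProbabilityMeasure_map (μ := μ) (hg 0).aemeasurable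
    rw [← (hlaw 0).map_eq]
    infer_instance
  have hXm : Measurable fun ω i => X i ω := measurable_pi_lambda _ hX
  have hgm : Measurable fun ω i => g i ω := measurable_pi_lambda _ hg
  have hjoint : Measurable fun z : (ℕ → Plane) × (ℕ → ℝ) =>
      ∏ i ∈ s, expNeg (H (z.1 i) (z.2 i)) := by
    refine Finset.measurable_prod _ fun i _ => measurable_expNeg.comp ?_
    exact hH.comp (f := fun z : (ℕ → Plane) × (ℕ → ℝ) => (z.1 i, z.2 i)) (by fun_prop)
  have hK : Measurable fun x : ℕ → Plane => ∏ i ∈ s, ∫⁻ u, expNeg (H (x i) u) ∂ν :=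
    Finset.measurable_prod _ fun i _ =>
      (measurable_expNeg.comp hH).lintegral_prod_right'.comp (measurable_pi_apply i)
  simp_rw [expNeg_sum]
  calc ∫⁻ ω, ∏ i ∈ s, expNeg (H (X i ω) (g i ω)) ∂μ
      = ∫⁻ z, ∏ i ∈ s, expNeg (H (z.1 i) (z.2 i))
          ∂(μ.map fun ω => ((fun i => X i ω), fun i => g i ω)) :=
        (lintegral_map hjoint (hXm.prodMk hgm)).symm
    _ = ∫⁻ x, ∫⁻ u, ∏ i ∈ s, expNeg (H (x i) (u i))
          ∂(μ.map fun ω i => g i ω) ∂(μ.map fun ω i => X i ω) := by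
        rw [(indepFun_iff_map_prod_eq_prod_map_map hXm.aemeasurable hgm.aemeasurable).1 hXg]
        have := Measure.isProbabilityMeasure_map (μ := μ) hgm.aemeasurable
        exact lintegral_prod _ hjoint.aemeasurable
    _ = ∫⁻ x, ∏ i ∈ s, ∫⁻ u, expNeg (H (x i) u) ∂ν ∂(μ.map fun ω i => X i ω) := by
        refine lintegral_congr fun x => ?_
        have hx : Measurable fun u : ℕ → ℝ => ∏ i ∈ s, expNeg (H (x i) (u i)) :=
          Finset.measurable_prod _ fun i _ => (hHx _).comp (measurable_pi_apply i)
        have hi : iIndepFun (fun i ω => expNeg (H (x i) (g i ω))) μ :=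
          hind.comp (fun i u => expNeg (H (x i) u)) fun i => hHx _
        rw [lintegral_map hx hgm,
          lintegral_prod_eq_prod_lintegral_of_indepFun _ _ hi fun i => (hHx _).comp (hg i)]
        refine Finset.prod_congr rfl fun i _ => ?_
        rw [← (hlaw i).map_eq, lintegral_map (hHx _) (hg i)]
    _ = _ := lintegral_map hK hXm

lemma tendsto_lintegral_expNeg_sum [IsProbabilityMeasure μ] {a : ℕ → Ω → ℝ≥0∞}
    (ha : ∀ i, Measurable (a i)) :
    Tendsto (fun n => ∫⁻ ω, expNeg (∑ i ∈ Finset.range n, a i ω) ∂μ) atTop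
      (𝓝 (∫⁻ ω, expNeg (∑' i, a i ω) ∂μ)) :=
  tendsto_lintegral_of_dominated_convergence (fun _ => 1)
    (fun _ => measurable_expNeg.comp (Finset.measurable_sum _ fun i _ => ha i))
    (fun _ => .of_forall fun _ => expNeg_le_one _) (by simp)
    (.of_forall fun _ =>
      (continuous_expNeg.tendsto _).comp ENNReal.summable.hasSum.tendsto_sum_nat)

/-- The Laplace functional of a homogeneous Poisson point process with independent marks of common
law `ν`: such a marked process is a Poisson process of intensity `lam` times area times `ν`. -/
theorem IsPoissonPointProcess.lintegral_expNeg_tsum_marked [IsProbabilityMeasure μ]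
    (hX : IsPoissonPointProcess μ lam X) (hlam : 0 ≤ lam) {ν : Measure ℝ}
    [IsProbabilityMeasure ν] {g : ℕ → Ω → ℝ} (hg : ∀ i, Measurable (g i))
    (hlaw : ∀ i, HasLaw (g i) ν μ) (hind : iIndepFun g μ)
    (hXg : IndepFun (fun ω i => X i ω) (fun ω i => g i ω) μ)
    {H : Plane → ℝ → ℝ≥0∞} (hH : Measurable (Function.uncurry H)) :
    ∫⁻ ω, expNeg (∑' i, H (X i ω) (g i ω)) ∂μ =
      expNeg (ENNReal.ofReal lam * ∫⁻ x, ∫⁻ u, (1 - expNeg (H x u)) ∂ν) := by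
  have hHx : ∀ x, Measurable fun u => expNeg (H x u) := fun x =>
    measurable_expNeg.comp hH.of_uncurry_left
  -- integrating out the marks leaves the unmarked process with `e^{-f}` the mean of `e^{-H}`
  obtain ⟨f, hfm, hf⟩ : ∃ f : Plane → ℝ≥0∞, Measurable f ∧
      ∀ x, expNeg (f x) = ∫⁻ u, expNeg (H x u) ∂ν := by
    refine ⟨fun x => (-ENNReal.log (∫⁻ u, expNeg (H x u) ∂ν)).toENNReal,
      (measurable_expNeg.comp hH).lintegral_prod_right'.ennreal_log.neg.ereal_toENNReal,
      fun x => expNeg_neg_log ?_⟩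
    exact (lintegral_mono fun u => expNeg_le_one (H x u)).trans (by simp)
  have hsub : ∀ x, ∫⁻ u, (1 - expNeg (H x u)) ∂ν = 1 - expNeg (f x) := fun x => by
    have hfin : ∫⁻ u, expNeg (H x u) ∂ν ≠ ⊤ :=
      hf x ▸ ((expNeg_le_one (f x)).trans_lt ENNReal.one_lt_top).ne
    rw [lintegral_sub (hHx x) hfin (.of_forall fun u => expNeg_le_one _), hf x]
    simp
  have h1 := tendsto_lintegral_expNeg_sum (μ := μ) (a := fun i ω => H (X i ω) (g i ω))
    fun i => hH.comp ((hX.measurable i).prodMk (hg i))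
  have h2 := tendsto_lintegral_expNeg_sum (μ := μ) (a := fun i ω => f (X i ω))
    fun i => hfm.comp (hX.measurable i)
  simp_rw [lintegral_expNeg_sum_marked hX.measurable hg hlaw hind hXg hH, ← hf, ← expNeg_sum] at h1
  rw [tendsto_nhds_unique h1 h2, hX.lintegral_expNeg_tsum hlam hfm]
  simp_rw [hsub]

end Poisson

/-! ### The intensity of the received powers -/

lemma lintegral_expMeasure_one (F : ℝ → ℝ≥0∞) :
    ∫⁻ u, F u ∂(expMeasure 1) = ∫⁻ u in Ioi 0, ENNReal.ofReal (Real.exp (-u)) * F u := by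
  have hd : Measurable (exponentialPDF 1) := (measurable_exponentialPDFReal 1).ennreal_ofReal
  have h : expMeasure 1 = volume.withDensity (exponentialPDF 1) := rfl
  rw [h, lintegral_withDensity_eq_lintegral_mul_non_measurable _ hd (.of_forall fun u => by
    exact ENNReal.ofReal_lt_top), ← lintegral_indicator measurableSet_Ioi]
  refine lintegral_congr_ae ?_
  filter_upwards [(show ∀ᵐ u : ℝ, u ≠ 0 by simp [ae_iff])] with u hu
  rcases lt_or_gt_of_ne hu with h | h
  · rw [indicator_of_notMem (by simpa using h.le)]
    rw [Pi.mul_apply, exponentialPDF_of_neg h, zero_mul]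
  · rw [indicator_of_mem (by simpa using h)]
    rw [Pi.mul_apply, exponentialPDF_of_nonneg h.le, one_mul, one_mul]

/-- The fractional moments of the exponential distribution. -/
lemma lintegral_rpow_expMeasure_one {s : ℝ} (hs : -1 < s) :
    ∫⁻ u, ENNReal.ofReal (u ^ s) ∂(expMeasure 1) = ENNReal.ofReal (Real.Gamma (1 + s)) := by
  have hs' : 0 < 1 + s := by linarith
  rw [lintegral_expMeasure_one, Real.Gamma_eq_integral hs',
    ofReal_integral_eq_lintegral_ofReal (Real.GammaIntegral_convergent hs')]
  · refine setLIntegral_congr_fun measurableSet_Ioi fun u _ => ?_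
    rw [← ENNReal.ofReal_mul (Real.exp_pos _).le, add_sub_cancel_left]
  · filter_upwards [ae_restrict_mem measurableSet_Ioi] with u hu
    exact mul_nonneg (Real.exp_pos _).le (Real.rpow_nonneg (le_of_lt hu) _)

namespace Params

variable (p : Params)

/-- Power received at `y` from a transmitter at `x` whose channel gain is `u`. -/
noncomputable def signal (y x : Plane) (u : ℝ) : ℝ≥0∞ :=
  ENNReal.ofReal p.Pd * edist y x ^ (-p.αd) * ENNReal.ofReal u

@[fun_prop] lemma measurable_signal (y : Plane) : Measurable (Function.uncurry (p.signal y)) := by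
  unfold signal Function.uncurry
  fun_prop

/-- Per unit of density of the transmitters, the intensity measure of the Poisson process formed
by the powers that are received at `y` from the individual transmitters. -/
noncomputable def signalMeasure (y : Plane) : Measure ℝ≥0∞ :=
  (volume.prod (expMeasure 1)).map (Function.uncurry (p.signal y))

lemma lintegral_signalMeasure (y : Plane) {φ : ℝ≥0∞ → ℝ≥0∞} (hφ : Measurable φ) :
    ∫⁻ a, φ a ∂(p.signalMeasure y) = ∫⁻ x, ∫⁻ u, φ (p.signal y x u) ∂(expMeasure 1) := by
  have := isProbabilityMeasure_expMeasure one_pos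
  rw [signalMeasure, lintegral_map hφ (p.measurable_signal y),
    lintegral_prod (fun z => φ (Function.uncurry (p.signal y) z))
      (hφ.comp (p.measurable_signal y)).aemeasurable]
  rfl

/-- Lebesgue measure is translation invariant, so all locations see the same received powers. -/
lemma signalMeasure_eq (y y' : Plane) : p.signalMeasure y = p.signalMeasure y' := by
  refine Measure.ext_of_lintegral _ fun φ hφ => ?_
  rw [p.lintegral_signalMeasure y hφ, p.lintegral_signalMeasure y' hφ,
    ← lintegral_add_right_eq_self _ (y - y')]
  refine lintegral_congr fun x => lintegral_congr fun u => ?_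
  have : edist y (x + (y - y')) = edist y' x := by
    rw [edist_eq_enorm_sub, edist_eq_enorm_sub]
    congr 1
    abel
  simp only [signal, this]

variable {p}

lemma ofReal_lt_signal_iff (hPd : 0 < p.Pd) (hαd : 0 < p.αd) {u t : ℝ} (hu : 0 < u) (ht : 0 < t)
    (y x : Plane) :
    ENNReal.ofReal t < p.signal y x u ↔ dist x y < (p.Pd * u / t) ^ (1 / p.αd) := by
  have hpos : 0 < p.Pd * u / t := by positivity
  rcases eq_or_ne x y with rfl | hxy
  · simp [signal, hαd, hPd, hu, Real.rpow_pos_of_pos hpos]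
  · have hd : 0 < dist x y := dist_pos.2 hxy
    have hdα : 0 < dist x y ^ p.αd := Real.rpow_pos_of_pos hd _
    rw [signal, edist_comm, edist_dist, ENNReal.ofReal_rpow_of_pos hd, ← ENNReal.ofReal_mul hPd.le,
      ← ENNReal.ofReal_mul (by positivity), ENNReal.ofReal_lt_ofReal_iff (by positivity),
      one_div, Real.lt_rpow_inv_iff_of_pos hd.le hpos.le hαd, lt_div_iff₀ ht, Real.rpow_neg hd.le]
    rw [mul_right_comm, ← div_eq_mul_inv, lt_div_iff₀ hdα, mul_comm t]

/-- The tail of the intensity of the received powers: a transmitter of gain `u` is received with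
power above `t` in a disk of radius `(P_d u / t) ^ (1 / α_d)`. -/
lemma signalMeasure_Ioi (hPd : 0 < p.Pd) (hαd : 0 < p.αd) (y : Plane) {t : ℝ} (ht : 0 < t) :
    p.signalMeasure y (Ioi (ENNReal.ofReal t)) =
      ENNReal.ofReal (Real.pi * Real.Gamma (1 + 2 / p.αd) * (t / p.Pd) ^ (-2 / p.αd)) := by
  have := isProbabilityMeasure_expMeasure one_pos
  have hδ : 0 < 2 / p.αd := by positivity
  have hΓ : 0 < Real.Gamma (1 + 2 / p.αd) := Real.Gamma_pos_of_pos (by linarith)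
  rw [signalMeasure, Measure.map_apply (p.measurable_signal y) measurableSet_Ioi,
    Measure.prod_apply_symm (p.measurable_signal y measurableSet_Ioi), lintegral_expMeasure_one]
  have hvol : ∀ u ∈ Ioi (0 : ℝ), ENNReal.ofReal (Real.exp (-u)) *
      volume ((fun x => (x, u)) ⁻¹' (Function.uncurry (p.signal y) ⁻¹' Ioi (ENNReal.ofReal t))) =
      ENNReal.ofReal (Real.exp (-u)) * (ENNReal.ofReal (Real.pi * (t / p.Pd) ^ (-2 / p.αd)) *
        ENNReal.ofReal (u ^ (2 / p.αd))) := by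
    intro u hu
    rw [mem_Ioi] at hu
    have hset : (fun x => (x, u)) ⁻¹' (Function.uncurry (p.signal y) ⁻¹' Ioi (ENNReal.ofReal t)) =
        Metric.ball y ((p.Pd * u / t) ^ (1 / p.αd)) := by
      ext x
      exact ofReal_lt_signal_iff hPd hαd hu ht y x
    have hpow : ((p.Pd * u / t) ^ (1 / p.αd)) ^ 2 = (t / p.Pd) ^ (-2 / p.αd) * u ^ (2 / p.αd) := by
      rw [← Real.rpow_natCast, ← Real.rpow_mul (by positivity), neg_div,
        Real.rpow_neg (by positivity), ← Real.inv_rpow (by positivity),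
        ← Real.mul_rpow (by positivity) hu.le]
      congr 1
      · field_simp
      · push_cast; ring
    rw [hset, EuclideanSpace.volume_ball_fin_two, ← ENNReal.ofReal_pow (by positivity), hpow]
    congr 1
    rw [← ENNReal.ofReal_mul (by positivity), ← ENNReal.ofReal_mul (by positivity)]
    congr 1
    ring
  rw [setLIntegral_congr_fun measurableSet_Ioi hvol, ← lintegral_expMeasure_one,
    lintegral_const_mul _ (by fun_prop), lintegral_rpow_expMeasure_one (by linarith),
    ← ENNReal.ofReal_mul (by positivity)]
  congr 1
  ring

/-- The mean total of the received powers that are at most `T`, by the layer cake formula. -/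
lemma setLIntegral_signalMeasure_Iic (hPd : 0 < p.Pd) (hαd : 2 < p.αd) (y : Plane) {T : ℝ}
    (hT : 0 < T) :
    ∫⁻ a in Iic (ENNReal.ofReal T), a ∂(p.signalMeasure y) =
      ENNReal.ofReal (T * (2 / (p.αd - 2)) *
        (Real.pi * Real.Gamma (1 + 2 / p.αd) * (T / p.Pd) ^ (-2 / p.αd))) := by
  have hα0 : 0 < p.αd := by linarith
  set δ : ℝ := 2 / p.αd with hδ
  have hδ0 : 0 < δ := by positivity
  have hδ1 : δ < 1 := (div_lt_one hα0).2 hαd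
  have hΓ : 0 < Real.Gamma (1 + δ) := Real.Gamma_pos_of_pos (by linarith)
  set c : ℝ := Real.pi * Real.Gamma (1 + δ) * p.Pd ^ δ with hc
  have hc0 : 0 < c := by positivity
  have hrw : ∀ t : ℝ, 0 < t →
      Real.pi * Real.Gamma (1 + δ) * (t / p.Pd) ^ (-2 / p.αd) = c * t ^ (-δ) := by
    intro t ht
    rw [neg_div, ← hδ, Real.div_rpow ht.le hPd.le, Real.rpow_neg hPd.le, hc]
    field_simp
  have htail : ∀ t : ℝ, 0 < t →
      p.signalMeasure y (Ioi (ENNReal.ofReal t)) = ENNReal.ofReal (c * t ^ (-δ)) :=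
    fun t ht => by rw [signalMeasure_Ioi hPd hα0 y ht, ← hδ, hrw t ht]
  let f : ℝ≥0∞ → ℝ := (Iic (ENNReal.ofReal T)).indicator ENNReal.toReal
  have hf : Measurable f := ENNReal.measurable_toReal.indicator measurableSet_Iic
  have hf0 : ∀ a, 0 ≤ f a := fun a => indicator_nonneg (fun a _ => ENNReal.toReal_nonneg) a
  have hlevel : ∀ t ∈ Ioi (0 : ℝ), p.signalMeasure y {a | t < f a} =
      (Ioc 0 T).indicator (fun t => ENNReal.ofReal (c * t ^ (-δ) - c * T ^ (-δ))) t := by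
    intro t ht
    rw [mem_Ioi] at ht
    have hset : {a | t < f a} = Ioi (ENNReal.ofReal t) \ Ioi (ENNReal.ofReal T) := by
      ext a
      simp only [f, mem_ofPred_eq, Set.mem_sdiff, mem_Ioi, not_lt]
      by_cases ha : a ≤ ENNReal.ofReal T
      · rw [indicator_of_mem (by exact ha),
          ENNReal.ofReal_lt_iff_lt_toReal ht.le (ha.trans_lt ENNReal.ofReal_lt_top).ne]
        simp [ha]
      · rw [indicator_of_notMem (by exact ha)]
        simp [ha, ht.le]
    rw [hset]
    by_cases htT : t ≤ T
    · rw [measure_sdiff (Ioi_subset_Ioi (ENNReal.ofReal_le_ofReal htT))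
        measurableSet_Ioi.nullMeasurableSet (by rw [htail T hT]; simp), htail t ht, htail T hT,
        indicator_of_mem (by exact ⟨ht, htT⟩), ENNReal.ofReal_sub _ (by positivity)]
    · rw [indicator_of_notMem (fun h => htT h.2), sdiff_eq_empty.2, measure_empty]
      exact Ioi_subset_Ioi (ENNReal.ofReal_le_ofReal (not_le.1 htT).le)
  have hintg : IntervalIntegrable (fun t : ℝ => c * t ^ (-δ) - c * T ^ (-δ)) volume 0 T :=
    ((intervalIntegral.intervalIntegrable_rpow' (by linarith)).const_mul _).sub
      intervalIntegrable_const
  have hval : ∫ t in (0 : ℝ)..T, (c * t ^ (-δ) - c * T ^ (-δ)) =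
      T * (2 / (p.αd - 2)) * (c * T ^ (-δ)) := by
    rw [intervalIntegral.integral_sub
      ((intervalIntegral.intervalIntegrable_rpow' (by linarith)).const_mul _)
      intervalIntegrable_const, intervalIntegral.integral_const_mul,
      integral_rpow (.inl (by linarith)), intervalIntegral.integral_const,
      Real.zero_rpow (by linarith), Real.rpow_add hT, Real.rpow_one]
    have h2 : p.αd - 2 ≠ 0 := by linarith
    have h3 : -δ + 1 = (p.αd - 2) / p.αd := by rw [hδ]; field_simp; ring
    rw [h3, smul_eq_mul]
    field_simp
    ring
  calc ∫⁻ a in Iic (ENNReal.ofReal T), a ∂(p.signalMeasure y)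
      = ∫⁻ a, ENNReal.ofReal (f a) ∂(p.signalMeasure y) := by
        rw [← lintegral_indicator measurableSet_Iic]
        refine lintegral_congr fun a => ?_
        by_cases ha : a ∈ Iic (ENNReal.ofReal T)
        · have : a ≠ ⊤ := ((mem_Iic.1 ha).trans_lt ENNReal.ofReal_lt_top).ne
          simp only [f]
          rw [indicator_of_mem ha, indicator_of_mem ha, ENNReal.ofReal_toReal this]
        · simp only [f]
          rw [indicator_of_notMem ha, indicator_of_notMem ha, ENNReal.ofReal_zero]
    _ = ∫⁻ t in Ioi 0, p.signalMeasure y {a | t < f a} :=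
        lintegral_eq_lintegral_meas_lt _ (.of_forall hf0) hf.aemeasurable
    _ = ∫⁻ t in Ioc 0 T, ENNReal.ofReal (c * t ^ (-δ) - c * T ^ (-δ)) := by
        rw [setLIntegral_congr_fun measurableSet_Ioi hlevel,
          setLIntegral_indicator measurableSet_Ioc, inter_eq_left.2 Ioc_subset_Ioi_self]
    _ = ENNReal.ofReal (∫ t in Ioc 0 T, (c * t ^ (-δ) - c * T ^ (-δ))) := by
        rw [ofReal_integral_eq_lintegral_ofReal
          ((intervalIntegrable_iff_integrableOn_Ioc_of_le hT.le).1 hintg)]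
        filter_upwards [ae_restrict_mem measurableSet_Ioc] with t ht
        rw [Pi.zero_apply, sub_nonneg]
        exact mul_le_mul_of_nonneg_left
          (Real.rpow_le_rpow_of_nonpos ht.1 ht.2 (by linarith)) hc0.le
    _ = _ := by
        rw [← intervalIntegral.integral_of_le hT.le, hval, ← hrw T hT]

end Params

/-! ### Random variables determined by their moments -/

/-- Two random variables with values in `[0, 1]` and equal moments have the same law, since by
Weierstrass polynomials are dense in `C([0, 1])`. -/
lemma map_eq_map_of_moments_eq {Ω : Type*} [MeasurableSpace Ω] {μ : Measure Ω}
    [IsProbabilityMeasure μ] {Z W : Ω → ℝ} (hZ : Measurable Z) (hW : Measurable W)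
    (hZ01 : ∀ ω, Z ω ∈ Icc (0 : ℝ) 1) (hW01 : ∀ ω, W ω ∈ Icc (0 : ℝ) 1)
    (h : ∀ n : ℕ, ∫ ω, Z ω ^ n ∂μ = ∫ ω, W ω ^ n ∂μ) : μ.map Z = μ.map W := by
  have := Measure.isProbabilityMeasure_map (μ := μ) hZ.aemeasurable
  have := Measure.isProbabilityMeasure_map (μ := μ) hW.aemeasurable
  have hint : ∀ V : Ω → ℝ, Measurable V → (∀ ω, V ω ∈ Icc (0 : ℝ) 1) → ∀ f : ℝ → ℝ,
      Continuous f → Integrable (fun ω => f (V ω)) μ := by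
    intro V hV hV01 f hf
    obtain ⟨C, hC⟩ := (isCompact_Icc.image hf).isBounded.exists_norm_le
    exact .of_bound (hf.measurable.comp hV).aestronglyMeasurable C
      (.of_forall fun ω => hC _ (mem_image_of_mem f (hV01 ω)))
  have hpoly : ∀ q : Polynomial ℝ, ∫ ω, q.eval (Z ω) ∂μ = ∫ ω, q.eval (W ω) ∂μ := by
    intro q
    simp_rw [Polynomial.eval_eq_sum_range]
    rw [integral_finsetSum _ fun n _ => (hint Z hZ hZ01 (· ^ n) (by fun_prop)).const_mul _,
      integral_finsetSum _ fun n _ => (hint W hW hW01 (· ^ n) (by fun_prop)).const_mul _]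
    simp_rw [integral_const_mul, h]
  refine ext_of_forall_integral_eq_of_IsFiniteMeasure fun f => ?_
  rw [integral_map hZ.aemeasurable f.continuous.aestronglyMeasurable,
    integral_map hW.aemeasurable f.continuous.aestronglyMeasurable]
  refine eq_of_forall_dist_le fun ε hε => ?_
  obtain ⟨q, hq⟩ := exists_polynomial_near_of_continuousOn 0 1 f f.continuous.continuousOn (ε / 2)
    (half_pos hε)
  have hclose : ∀ V : Ω → ℝ, Measurable V → (∀ ω, V ω ∈ Icc (0 : ℝ) 1) →
      |∫ ω, q.eval (V ω) ∂μ - ∫ ω, f (V ω) ∂μ| ≤ ε / 2 := by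
    intro V hV hV01
    rw [← integral_sub (hint V hV hV01 _ q.continuous) (hint V hV hV01 _ f.continuous)]
    have := norm_integral_le_of_norm_le_const (μ := μ) (f := fun ω => q.eval (V ω) - f (V ω))
      (C := ε / 2) (.of_forall fun ω => (hq _ (hV01 ω)).le)
    simpa using this
  have h1 := abs_le.1 (hclose Z hZ hZ01)
  have h2 := abs_le.1 (hclose W hW hW01)
  rw [hpoly] at h1
  rw [Real.dist_eq, abs_le]
  constructor <;> linarith [h1.1, h1.2, h2.1, h2.2]

/-! ### Bounds on the distribution function of the interference -/

namespace Params

variable (p : Params)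

/-- The mean number of transmitters whose signal alone is received with power above `T`. -/
noncomputable def meanExceed (T : ℝ) : ℝ :=
  Real.pi * p.lam * (T / p.Pd) ^ (-2 / p.αd) * Real.Gamma (1 + 2 / p.αd)

lemma upperCDF_of_pos {T : ℝ} (hT : 0 < T) : p.upperCDF T = Real.exp (-p.meanExceed T) := by
  rw [upperCDF, if_pos hT, meanExceed]

lemma lowerCDF_of_pos {T : ℝ} (hT : 0 < T) :
    p.lowerCDF T = (1 - 2 / (p.αd - 2) * p.meanExceed T) * Real.exp (-p.meanExceed T) := by
  rw [lowerCDF, if_pos hT, meanExceed]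
  ring

variable {p}

lemma meanExceed_nonneg (hPd : 0 < p.Pd) (hαd : 0 < p.αd) (hlam : 0 ≤ p.lam) {T : ℝ} (hT : 0 < T) :
    0 ≤ p.meanExceed T := by
  have : 0 < Real.Gamma (1 + 2 / p.αd) := Real.Gamma_pos_of_pos (by positivity)
  unfold meanExceed
  positivity

lemma ofReal_lam_mul_signalMeasure_Ioi (hPd : 0 < p.Pd) (hαd : 0 < p.αd) (hlam : 0 ≤ p.lam)
    (y : Plane) {T : ℝ} (hT : 0 < T) :
    ENNReal.ofReal p.lam * p.signalMeasure y (Ioi (ENNReal.ofReal T)) =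
      ENNReal.ofReal (p.meanExceed T) := by
  rw [signalMeasure_Ioi hPd hαd y hT, ← ENNReal.ofReal_mul hlam, meanExceed]
  congr 1
  ring

lemma ofReal_lam_mul_setLIntegral_signalMeasure (hPd : 0 < p.Pd) (hαd : 2 < p.αd)
    (hlam : 0 ≤ p.lam) (y : Plane) {T : ℝ} (hT : 0 < T) :
    ENNReal.ofReal p.lam * ∫⁻ a in Iic (ENNReal.ofReal T), a ∂(p.signalMeasure y) =
      ENNReal.ofReal (T * (2 / (p.αd - 2) * p.meanExceed T)) := by
  rw [setLIntegral_signalMeasure_Iic hPd hαd y hT, ← ENNReal.ofReal_mul hlam, meanExceed]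
  congr 1
  ring

end Params

namespace Network

variable {Ω : Type*} [MeasurableSpace Ω] {μ : Measure Ω} {p : Params} (S : Network μ p)

lemma interference_eq_tsum_signal (y : Plane) (ω : Ω) :
    S.interference y ω = ∑' i, p.signal y (S.X i ω) (S.g y i ω) := rfl

lemma measurable_signal_X (y : Plane) (i : ℕ) :
    Measurable fun ω => p.signal y (S.X i ω) (S.g y i ω) := by
  have hX := S.poisson.measurable i
  have hg := S.measurable_g y i
  unfold Params.signal
  fun_prop

lemma measurable_interference (y : Plane) : Measurable (S.interference y) :=
  Measurable.tsum fun i => S.measurable_signal_X y i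


/-- The event that no single transmitter is received with power above `T`. -/
def noExceed (y : Plane) (T : ℝ) : Set Ω :=
  {ω | ∀ i, p.signal y (S.X i ω) (S.g y i ω) ≤ ENNReal.ofReal T}

lemma measurableSet_noExceed (y : Plane) (T : ℝ) : MeasurableSet (S.noExceed y T) := by
  simp only [noExceed, ofPred_forall]
  exact .iInter fun i => measurableSet_le (S.measurable_signal_X y i) measurable_const

lemma interference_le_subset_noExceed (y : Plane) (T : ℝ) :
    {ω | S.interference y ω ≤ ENNReal.ofReal T} ⊆ S.noExceed y T := fun _ hω i =>
  (ENNReal.le_tsum i).trans hω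

/-- Markov's inequality in exponential form, on the event that no single transmitter exceeds
`T`. -/
lemma lintegral_noExceed_le (y : Plane) {T t : ℝ} (hT : 0 < T) (ht : 0 ≤ t) :
    ∫⁻ ω in S.noExceed y T, expNeg (ENNReal.ofReal t * S.interference y ω) ∂μ ≤
      ENNReal.ofReal (1 - Real.exp (-(t * T))) * μ {ω | S.interference y ω ≤ ENNReal.ofReal T} +
        ENNReal.ofReal (Real.exp (-(t * T))) * μ (S.noExceed y T) := by
  have hA : MeasurableSet {ω | S.interference y ω ≤ ENNReal.ofReal T} :=
    measurableSet_le (S.measurable_interference y) measurable_const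
  have hE := S.measurableSet_noExceed y T
  rw [← lintegral_indicator hE, ← lintegral_indicator_const hA, ← lintegral_indicator_const hE,
    ← lintegral_add_left (measurable_const.indicator hA)]
  refine lintegral_mono fun ω => ?_
  by_cases hω : ω ∈ S.noExceed y T
  · rw [indicator_of_mem hω, indicator_of_mem hω]
    by_cases hI : S.interference y ω ≤ ENNReal.ofReal T
    · rw [indicator_of_mem (by exact hI), ← ENNReal.ofReal_add _ (Real.exp_pos _).le,
        sub_add_cancel, ENNReal.ofReal_one]
      · exact expNeg_le_one _
      · rw [sub_nonneg, Real.exp_le_one_iff]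
        have := mul_nonneg ht hT.le
        linarith
    · rw [indicator_of_notMem (by exact hI), zero_add,
        ← expNeg_ofReal (mul_nonneg ht hT.le), ENNReal.ofReal_mul ht]
      exact antitone_expNeg (by gcongr; exact (not_le.1 hI).le)
  · rw [indicator_of_notMem hω]
    exact zero_le

variable [IsProbabilityMeasure μ]

/-- The Laplace functional of the point process of the powers received at `y` from the individual
transmitters. -/
lemma lintegral_expNeg_tsum_signal (hlam : 0 ≤ p.lam) (y : Plane) {φ : ℝ≥0∞ → ℝ≥0∞}
    (hφ : Measurable φ) :
    ∫⁻ ω, expNeg (∑' i, φ (p.signal y (S.X i ω) (S.g y i ω))) ∂μ =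
      expNeg (ENNReal.ofReal p.lam * ∫⁻ a, (1 - expNeg (φ a)) ∂(p.signalMeasure y)) := by
  have := isProbabilityMeasure_expMeasure one_pos
  rw [S.poisson.lintegral_expNeg_tsum_marked (H := fun x u => φ (p.signal y x u)) hlam
    (S.measurable_g y) (S.law_g y) (S.indep_g y) (S.indep_X_g y)
    (hφ.comp (p.measurable_signal y)),
    p.lintegral_signalMeasure (φ := fun a => 1 - expNeg (φ a)) y (by fun_prop)]

/-- The void probability of the point process of received powers. -/
lemma measure_noExceed (hPd : 0 < p.Pd) (hαd : 0 < p.αd) (hlam : 0 ≤ p.lam) (y : Plane) {T : ℝ}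
    (hT : 0 < T) : μ (S.noExceed y T) = ENNReal.ofReal (Real.exp (-p.meanExceed T)) := by
  let φ : ℝ≥0∞ → ℝ≥0∞ := (Ioi (ENNReal.ofReal T)).indicator fun _ => ⊤
  have hφ : Measurable φ := measurable_const.indicator measurableSet_Ioi
  have h1 : ∀ ω, expNeg (∑' i, φ (p.signal y (S.X i ω) (S.g y i ω))) =
      (S.noExceed y T).indicator 1 ω := by
    intro ω
    by_cases hω : ω ∈ S.noExceed y T
    · rw [indicator_of_mem hω, ENNReal.tsum_eq_zero.2, expNeg_zero, Pi.one_apply]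
      exact fun i => indicator_of_notMem (not_lt.2 (hω i)) _
    · rw [indicator_of_notMem hω]
      simp only [noExceed, mem_ofPred_eq, not_forall, not_le] at hω
      obtain ⟨i, hi⟩ := hω
      rw [ENNReal.tsum_eq_top_of_eq_top ⟨i, indicator_of_mem (s := Ioi _) hi _⟩, expNeg_top]
  have h2 : ∀ a, 1 - expNeg (φ a) = (Ioi (ENNReal.ofReal T)).indicator 1 a := by
    intro a
    by_cases ha : a ∈ Ioi (ENNReal.ofReal T)
    · simp [φ, indicator_of_mem ha]
    · simp [φ, indicator_of_notMem ha]
  have h := S.lintegral_expNeg_tsum_signal hlam y hφ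
  simp_rw [h1, h2] at h
  rw [lintegral_indicator_one (S.measurableSet_noExceed y T),
    lintegral_indicator_one measurableSet_Ioi,
    Params.ofReal_lam_mul_signalMeasure_Ioi hPd hαd hlam y hT,
    expNeg_ofReal (Params.meanExceed_nonneg hPd hαd hlam hT)] at h
  exact h

lemma measureReal_interference_le_upperCDF (hPd : 0 < p.Pd) (hαd : 0 < p.αd) (hlam : 0 ≤ p.lam)
    (y : Plane) {T : ℝ} (hT : 0 < T) :
    μ.real {ω | S.interference y ω ≤ ENNReal.ofReal T} ≤ p.upperCDF T := by
  refine (measureReal_mono (S.interference_le_subset_noExceed y T)).trans_eq ?_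
  rw [measureReal_def, S.measure_noExceed hPd hαd hlam y hT,
    ENNReal.toReal_ofReal (Real.exp_pos _).le, p.upperCDF_of_pos hT]

/-- A lower bound on the Laplace transform of the interference on the event that no single
transmitter exceeds `T`. -/
lemma exp_le_lintegral_noExceed (hPd : 0 < p.Pd) (hαd : 2 < p.αd) (hlam : 0 ≤ p.lam) (y : Plane)
    {T t : ℝ} (hT : 0 < T) (ht : 0 ≤ t) :
    ENNReal.ofReal (Real.exp (-p.meanExceed T) *
        Real.exp (-(t * (T * (2 / (p.αd - 2) * p.meanExceed T))))) ≤
      ∫⁻ ω in S.noExceed y T, expNeg (ENNReal.ofReal t * S.interference y ω) ∂μ := by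
  have hα0 : 0 < p.αd := by linarith
  have hm : 0 ≤ p.meanExceed T := Params.meanExceed_nonneg hPd hα0 hlam hT
  have hα2 : 0 < p.αd - 2 := by linarith
  let φ : ℝ≥0∞ → ℝ≥0∞ := fun a => if a ≤ ENNReal.ofReal T then ENNReal.ofReal t * a else ⊤
  have hφ : Measurable φ :=
    Measurable.ite measurableSet_Iic (measurable_const.mul measurable_id) measurable_const
  have h1 : ∀ ω, expNeg (∑' i, φ (p.signal y (S.X i ω) (S.g y i ω))) =
      (S.noExceed y T).indicator (fun ω => expNeg (ENNReal.ofReal t * S.interference y ω)) ω := by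
    intro ω
    by_cases hω : ω ∈ S.noExceed y T
    · rw [indicator_of_mem hω, interference_eq_tsum_signal, ← ENNReal.tsum_mul_left]
      congr 1
      exact tsum_congr fun i => if_pos (hω i)
    · rw [indicator_of_notMem hω]
      simp only [noExceed, mem_ofPred_eq, not_forall] at hω
      obtain ⟨i, hi⟩ := hω
      rw [ENNReal.tsum_eq_top_of_eq_top ⟨i, if_neg hi⟩, expNeg_top]
  have h2 : ∀ a, 1 - expNeg (φ a) ≤ (Ioi (ENNReal.ofReal T)).indicator 1 a +
      (Iic (ENNReal.ofReal T)).indicator (fun a => ENNReal.ofReal t * a) a := by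
    intro a
    by_cases ha : a ≤ ENNReal.ofReal T
    · rw [indicator_of_notMem (by simpa using ha), indicator_of_mem (by exact ha), zero_add]
      simp only [φ, if_pos ha]
      obtain ⟨b, hb0, rfl⟩ : ∃ b : ℝ, 0 ≤ b ∧ a = ENNReal.ofReal b :=
        ⟨a.toReal, ENNReal.toReal_nonneg,
          (ENNReal.ofReal_toReal (ha.trans_lt ENNReal.ofReal_lt_top).ne).symm⟩
      rw [← ENNReal.ofReal_mul ht, expNeg_ofReal (mul_nonneg ht hb0), ← ENNReal.ofReal_one,
        ← ENNReal.ofReal_sub _ (Real.exp_pos _).le]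
      exact ENNReal.ofReal_le_ofReal (by linarith [Real.add_one_le_exp (-(t * b))])
    · rw [indicator_of_mem (by simpa using ha)]
      exact tsub_le_self.trans le_self_add
  have h3 : ENNReal.ofReal p.lam * ∫⁻ a, (1 - expNeg (φ a)) ∂(p.signalMeasure y) ≤
      ENNReal.ofReal (p.meanExceed T + t * (T * (2 / (p.αd - 2) * p.meanExceed T))) := by
    calc _ ≤ ENNReal.ofReal p.lam * ∫⁻ a, ((Ioi (ENNReal.ofReal T)).indicator 1 a +
          (Iic (ENNReal.ofReal T)).indicator (fun a => ENNReal.ofReal t * a) a)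
            ∂(p.signalMeasure y) := by gcongr; exact h2 _
      _ = _ := by
        rw [lintegral_add_left (measurable_one.indicator measurableSet_Ioi),
          lintegral_indicator_one measurableSet_Ioi, lintegral_indicator measurableSet_Iic,
          lintegral_const_mul _ measurable_id', mul_add, mul_left_comm,
          Params.ofReal_lam_mul_signalMeasure_Ioi hPd hα0 hlam y hT,
          Params.ofReal_lam_mul_setLIntegral_signalMeasure hPd hαd hlam y hT,
          ← ENNReal.ofReal_mul ht, ← ENNReal.ofReal_add hm (by positivity)]
  have h := S.lintegral_expNeg_tsum_signal hlam y hφ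
  simp_rw [h1] at h
  rw [lintegral_indicator (S.measurableSet_noExceed y T)] at h
  rw [h, ← Real.exp_add, ← neg_add, ← expNeg_ofReal (by positivity)]
  exact antitone_expNeg h3

lemma lowerCDF_le_measureReal_interference (hPd : 0 < p.Pd) (hαd : 2 < p.αd) (hlam : 0 ≤ p.lam)
    (y : Plane) {T : ℝ} (hT : 0 < T) :
    p.lowerCDF T ≤ μ.real {ω | S.interference y ω ≤ ENNReal.ofReal T} := by
  have hα0 : 0 < p.αd := by linarith
  set P : ℝ := μ.real {ω | S.interference y ω ≤ ENNReal.ofReal T} with hP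
  set m : ℝ := p.meanExceed T with hm
  set k : ℝ := 2 / (p.αd - 2) * m with hk
  have hkey : ∀ t : ℝ, 0 < t →
      Real.exp (-m) * Real.exp (-(t * (T * k))) ≤
        (1 - Real.exp (-(t * T))) * P + Real.exp (-(t * T)) * Real.exp (-m) := by
    intro t ht
    have he : Real.exp (-(t * T)) ≤ 1 := by
      rw [Real.exp_le_one_iff]
      have := mul_pos ht hT
      linarith
    have h := (S.exp_le_lintegral_noExceed hPd hαd hlam y hT ht.le).trans
      (S.lintegral_noExceed_le y hT ht.le)
    rw [S.measure_noExceed hPd hα0 hlam y hT, ← ofReal_measureReal (measure_ne_top _ _), ← hP,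
      ← ENNReal.ofReal_mul (by linarith), ← ENNReal.ofReal_mul (Real.exp_pos _).le,
      ← ENNReal.ofReal_add (mul_nonneg (by linarith) measureReal_nonneg) (by positivity)] at h
    rwa [ENNReal.ofReal_le_ofReal_iff] at h
    exact add_nonneg (mul_nonneg (by linarith) measureReal_nonneg) (by positivity)
  -- divide by `t` and let `t → 0`
  have hslope : Tendsto (fun t : ℝ => (1 - Real.exp (-(t * T))) / t) (𝓝[>] 0) (𝓝 T) := by
    have hd : HasDerivAt (fun t : ℝ => 1 - Real.exp (-(t * T))) T 0 := by
      have := ((((hasDerivAt_id (0 : ℝ)).mul_const T).fun_neg).exp).const_sub 1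
      simpa using this
    have := hd.tendsto_slope_zero_right
    simpa [div_eq_inv_mul] using this
  have hL : Tendsto (fun t : ℝ => Real.exp (-m) * ((1 - Real.exp (-(t * T))) / t - T * k)) (𝓝[>] 0)
      (𝓝 (Real.exp (-m) * (T - T * k))) := (hslope.sub_const _).const_mul _
  have hR : Tendsto (fun t : ℝ => (1 - Real.exp (-(t * T))) / t * P) (𝓝[>] 0) (𝓝 (T * P)) :=
    hslope.mul_const _
  have hle := le_of_tendsto_of_tendsto hL hR (by
    filter_upwards [self_mem_nhdsWithin] with t ht
    have ht' : 0 < t := ht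
    have h1 := hkey t ht'
    have h2 := mul_le_mul_of_nonneg_left (Real.add_one_le_exp (-(t * (T * k))))
      (Real.exp_pos (-m)).le
    rw [div_mul_eq_mul_div, le_div_iff₀ ht']
    have h3 : Real.exp (-m) * ((1 - Real.exp (-(t * T))) / t - T * k) * t =
        Real.exp (-m) * (1 - Real.exp (-(t * T)) - t * (T * k)) := by
      field_simp
    rw [h3]
    linarith)
  rw [p.lowerCDF_of_pos hT, ← hm, ← hk]
  have : T * ((1 - k) * Real.exp (-m)) ≤ T * P := by linarith
  exact le_of_mul_le_mul_left this hT

/-- The law of the interference does not depend on the location, because its Laplace transform does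
not. -/
lemma measure_interference_le_eq (hlam : 0 ≤ p.lam) (y y' : Plane) (T : ℝ) :
    μ {ω | S.interference y ω ≤ ENNReal.ofReal T} =
      μ {ω | S.interference y' ω ≤ ENNReal.ofReal T} := by
  let Z : Plane → Ω → ℝ := fun y ω => (expNeg (S.interference y ω)).toReal
  have hZ : ∀ y, Measurable (Z y) := fun y =>
    (measurable_expNeg.comp (S.measurable_interference y)).ennreal_toReal
  have hZ01 : ∀ y ω, Z y ω ∈ Icc (0 : ℝ) 1 := fun y ω =>
    ⟨ENNReal.toReal_nonneg, by simpa using ENNReal.toReal_mono ENNReal.one_ne_top (expNeg_le_one _)⟩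
  have hmoment : ∀ y (n : ℕ), ∫ ω, Z y ω ^ n ∂μ = (expNeg (ENNReal.ofReal p.lam *
      ∫⁻ a, (1 - expNeg (a * n)) ∂(p.signalMeasure y))).toReal := by
    intro y n
    rw [← S.lintegral_expNeg_tsum_signal (φ := fun a => a * n) hlam y (by fun_prop)]
    simp_rw [ENNReal.tsum_mul_right, expNeg_mul_natCast, ← interference_eq_tsum_signal]
    rw [← integral_toReal (f := fun ω => expNeg (S.interference y ω) ^ n)
      ((measurable_expNeg.comp (S.measurable_interference y)).pow_const n).aemeasurable]
    · simp_rw [ENNReal.toReal_pow]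
      rfl
    · exact .of_forall fun ω =>
        ENNReal.pow_lt_top ((expNeg_le_one _).trans_lt ENNReal.one_lt_top)
  have hset : ∀ y, {ω | S.interference y ω ≤ ENNReal.ofReal T} =
      Z y ⁻¹' Ici (expNeg (ENNReal.ofReal T)).toReal := by
    intro y
    ext ω
    rw [mem_preimage, mem_Ici, ENNReal.toReal_le_toReal
      ((expNeg_le_one _).trans_lt ENNReal.one_lt_top).ne
      ((expNeg_le_one _).trans_lt ENNReal.one_lt_top).ne, expNeg_le_expNeg_iff]
    rfl
  have hlaw := map_eq_map_of_moments_eq (μ := μ) (hZ y) (hZ y') (hZ01 y) (hZ01 y') fun n => by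
    rw [hmoment, hmoment, p.signalMeasure_eq y y']
  rw [hset, hset, ← Measure.map_apply (hZ y) measurableSet_Ici,
    ← Measure.map_apply (hZ y') measurableSet_Ici, hlaw]

end Network

/-! ### Regularity of the integrands -/

lemma norm_polarPoint {r : ℝ} (hr : 0 ≤ r) (φ : ℝ) : ‖polarPoint r φ‖ = r := by
  rw [EuclideanSpace.norm_eq, Fin.sum_univ_two, Real.sqrt_eq_iff_eq_sq (by positivity) hr]
  simp only [polarPoint, Real.norm_eq_abs, sq_abs, PiLp.toLp_apply, Matrix.cons_val_zero,
    Matrix.cons_val_one]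
  nlinarith [Real.sin_sq_add_cos_sq φ]

namespace Params

variable (p : Params)

@[fun_prop] lemma measurable_distUAV : Measurable p.distUAV := by
  unfold distUAV
  fun_prop

@[fun_prop] lemma measurable_pLoS : Measurable p.pLoS := by
  have h : Measurable p.elevation := by
    unfold elevation
    exact measurable_const.mul
      (Real.measurable_arcsin.comp (measurable_const.div p.measurable_distUAV))
  unfold pLoS
  fun_prop

@[fun_prop] lemma measurable_pNLoS : Measurable p.pNLoS := by
  unfold pNLoS
  fun_prop

@[fun_prop] lemma measurable_powerLoS : Measurable p.powerLoS := by
  unfold powerLoS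
  fun_prop

@[fun_prop] lemma measurable_powerNLoS : Measurable p.powerNLoS := by
  unfold powerNLoS
  fun_prop

@[fun_prop] lemma measurable_upperCDF : Measurable p.upperCDF := by
  unfold upperCDF
  exact Measurable.ite measurableSet_Ioi (by fun_prop) measurable_const

@[fun_prop] lemma measurable_lowerCDF : Measurable p.lowerCDF := by
  unfold lowerCDF
  exact Measurable.ite measurableSet_Ioi (by fun_prop) measurable_const

variable {p}

lemma pLoS_mem_Icc (hC : 0 ≤ p.C) (r : ℝ) : p.pLoS r ∈ Icc (0 : ℝ) 1 := by
  have : 0 ≤ p.C * Real.exp (-p.B * (p.elevation r - p.C)) := mul_nonneg hC (Real.exp_pos _).le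
  unfold pLoS
  exact ⟨by positivity, div_le_one_of_le₀ (by linarith) (by linarith)⟩

lemma pNLoS_mem_Icc (hC : 0 ≤ p.C) (r : ℝ) : p.pNLoS r ∈ Icc (0 : ℝ) 1 := by
  have := pLoS_mem_Icc hC r
  unfold pNLoS
  exact ⟨by linarith [this.2], by linarith [this.1]⟩

lemma distUAV_pos (hh : 0 < p.h) (r : ℝ) : 0 < p.distUAV r := by
  unfold distUAV
  positivity

lemma powerLoS_pos (hPu : 0 < p.Pu) (hh : 0 < p.h) (r : ℝ) : 0 < p.powerLoS r :=
  mul_pos hPu (Real.rpow_pos_of_pos (distUAV_pos hh r) _)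

lemma powerNLoS_pos (hPu : 0 < p.Pu) (hη : 0 < p.η) (hh : 0 < p.h) (r : ℝ) :
    0 < p.powerNLoS r :=
  mul_pos (mul_pos hη hPu) (Real.rpow_pos_of_pos (distUAV_pos hh r) _)

lemma abs_upperCDF_le (hPd : 0 < p.Pd) (hαd : 0 < p.αd) (hlam : 0 ≤ p.lam) (T : ℝ) :
    |p.upperCDF T| ≤ 1 := by
  by_cases hT : 0 < T
  · rw [p.upperCDF_of_pos hT, abs_of_pos (Real.exp_pos _), Real.exp_le_one_iff]
    linarith [meanExceed_nonneg hPd hαd hlam hT]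
  · simp [upperCDF, hT]

lemma abs_lowerCDF_le (hPd : 0 < p.Pd) (hαd : 2 < p.αd) (hlam : 0 ≤ p.lam) (T : ℝ) :
    |p.lowerCDF T| ≤ 1 + 2 / (p.αd - 2) := by
  have hα2 : 0 < p.αd - 2 := by linarith
  by_cases hT : 0 < T
  · have hm := meanExceed_nonneg hPd (by linarith) hlam hT
    have hk : 0 < 2 / (p.αd - 2) := by positivity
    rw [p.lowerCDF_of_pos hT, Real.exp_neg, ← div_eq_mul_inv, abs_div,
      abs_of_pos (Real.exp_pos _), div_le_iff₀ (Real.exp_pos _)]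
    have h1 := Real.add_one_le_exp (p.meanExceed T)
    have h2 : |1 - 2 / (p.αd - 2) * p.meanExceed T| ≤ 1 + 2 / (p.αd - 2) * p.meanExceed T := by
      have := mul_nonneg hk.le hm
      rw [abs_le]
      constructor <;> linarith
    nlinarith [mul_le_mul_of_nonneg_left h1 hk.le]
  · simp only [lowerCDF, hT, if_false, abs_zero]
    positivity

lemma intervalIntegrable_of_bounded {w F q : ℝ → ℝ} (hw : Measurable w) (hF : Measurable F)
    (hq : Measurable q) (hw01 : ∀ r, w r ∈ Icc (0 : ℝ) 1) {K : ℝ} (hK : ∀ T, |F T| ≤ K)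
    (Rc : ℝ) : IntervalIntegrable (fun r => w r * F (q r) * (2 * r / Rc ^ 2)) volume 0 Rc := by
  refine IntervalIntegrable.mul_continuousOn ?_ (by fun_prop)
  refine (intervalIntegrable_const (c := K)).mono_fun
    (hw.mul (hF.comp hq)).aestronglyMeasurable (.of_forall fun r => ?_)
  simp only [norm_mul, Real.norm_of_nonneg (hw01 r).1]
  exact (mul_le_of_le_one_left (norm_nonneg _) (hw01 r).2).trans ((hK _).trans (le_abs_self K))

lemma intervalIntegrable_integrandLoS (hC : 0 ≤ p.C) {F : ℝ → ℝ} (hF : Measurable F) {K : ℝ}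
    (hK : ∀ T, |F T| ≤ K) (β Rc : ℝ) :
    IntervalIntegrable (p.integrandLoS β Rc F) volume 0 Rc :=
  intervalIntegrable_of_bounded p.measurable_pLoS hF (by fun_prop) (pLoS_mem_Icc hC) hK Rc

lemma intervalIntegrable_integrandNLoS (hC : 0 ≤ p.C) {F : ℝ → ℝ} (hF : Measurable F) {K : ℝ}
    (hK : ∀ T, |F T| ≤ K) (β Rc : ℝ) :
    IntervalIntegrable (p.integrandNLoS β Rc F) volume 0 Rc :=
  intervalIntegrable_of_bounded p.measurable_pNLoS hF (by fun_prop) (pNLoS_mem_Icc hC) hK Rc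

/-- The coverage bound is monotone in the distribution function it is built from. -/
lemma coverageBound_mono (hC : 0 ≤ p.C) {F F' : ℝ → ℝ} (hF : Measurable F) (hF' : Measurable F')
    {K K' : ℝ} (hK : ∀ T, |F T| ≤ K) (hK' : ∀ T, |F' T| ≤ K') (hFF' : ∀ T, F T ≤ F' T) (β : ℝ)
    {Rc : ℝ} (hRc : 0 ≤ Rc) : p.coverageBound β Rc F ≤ p.coverageBound β Rc F' := by
  have hr : ∀ r ∈ Icc 0 Rc, 0 ≤ 2 * r / Rc ^ 2 := fun r hr => by
    have := hr.1
    positivity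
  refine add_le_add
    (intervalIntegral.integral_mono_on hRc (intervalIntegrable_integrandLoS hC hF hK β Rc)
      (intervalIntegrable_integrandLoS hC hF' hK' β Rc) fun r h => ?_)
    (intervalIntegral.integral_mono_on hRc (intervalIntegrable_integrandNLoS hC hF hK β Rc)
      (intervalIntegrable_integrandNLoS hC hF' hK' β Rc) fun r h => ?_)
  · exact mul_le_mul_of_nonneg_right
      (mul_le_mul_of_nonneg_left (hFF' _) (pLoS_mem_Icc hC r).1) (hr r h)
  · exact mul_le_mul_of_nonneg_right
      (mul_le_mul_of_nonneg_left (hFF' _) (pNLoS_mem_Icc hC r).1) (hr r h)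

/-- The upper bound vanishes continuously at `0`. -/
lemma tendsto_upperCDF_zero (hPd : 0 < p.Pd) (hαd : 0 < p.αd) (hlam : 0 < p.lam) :
    Tendsto p.upperCDF (𝓝[>] 0) (𝓝 0) := by
  have hδ : 0 < 2 / p.αd := by positivity
  have hΓ : 0 < Real.Gamma (1 + 2 / p.αd) := Real.Gamma_pos_of_pos (by positivity)
  have h1 : Tendsto (fun T : ℝ => T / p.Pd) (𝓝[>] 0) (𝓝[>] 0) := by
    refine tendsto_nhdsWithin_iff.2 ⟨?_, ?_⟩
    · have : Tendsto (fun T : ℝ => T / p.Pd) (𝓝 0) (𝓝 (0 / p.Pd)) :=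
        tendsto_id.div_const _
      rw [zero_div] at this
      exact this.mono_left nhdsWithin_le_nhds
    · filter_upwards [self_mem_nhdsWithin] with T hT
      exact div_pos hT hPd
  have h2 : Tendsto p.meanExceed (𝓝[>] 0) atTop := by
    have h := (tendsto_rpow_neg_nhdsGT_zero (neg_lt_zero.2 hδ)).comp h1
    have h' := (h.const_mul_atTop (show 0 < Real.pi * p.lam by positivity)).atTop_mul_const hΓ
    refine h'.congr fun T => ?_
    simp only [meanExceed, Function.comp_apply, neg_div]
  refine (Real.tendsto_exp_neg_atTop_nhds_zero.comp h2).congr' ?_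
  filter_upwards [self_mem_nhdsWithin] with T hT
  exact (p.upperCDF_of_pos hT).symm

end Params

/-! ### The coverage probability -/

namespace Network

variable {Ω : Type*} [MeasurableSpace Ω] {μ : Measure Ω} {p : Params} (S : Network μ p)

/-- The distribution function of the interference, at the origin. It is the same at all
locations. The condition `0 ≤ T` is not redundant: `ENNReal.ofReal` sends negative `T` to `0`. -/
noncomputable def interferenceCDF (T : ℝ) : ℝ :=
  μ.real {ω | 0 ≤ T ∧ S.interference 0 ω ≤ ENNReal.ofReal T}

/-- The SINR reaches the threshold iff the interference is at most `q / β - N`. When this number is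
negative it is truncated by `ENNReal.ofReal`, and there is no coverage. -/
lemma le_div_add_iff {β q N : ℝ} (hβ : 0 < β) (hq : 0 < q) (hN : 0 ≤ N) (I : ℝ≥0∞) :
    ENNReal.ofReal β ≤ ENNReal.ofReal q / (I + ENNReal.ofReal N) ↔
      0 ≤ q / β - N ∧ I ≤ ENNReal.ofReal (q / β - N) := by
  rw [ENNReal.le_div_iff_mul_le (.inr (by simpa using hq)) (.inr ENNReal.ofReal_ne_top)]
  rcases eq_or_ne I ⊤ with rfl | hI
  · simp [hβ]
  · obtain ⟨i, hi, rfl⟩ : ∃ i : ℝ, 0 ≤ i ∧ I = ENNReal.ofReal i :=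
      ⟨I.toReal, ENNReal.toReal_nonneg, (ENNReal.ofReal_toReal hI).symm⟩
    rw [← ENNReal.ofReal_add hi hN, ← ENNReal.ofReal_mul hβ.le,
      ENNReal.ofReal_le_ofReal_iff hq.le, mul_comm, ← le_div_iff₀ hβ]
    constructor
    · intro h
      exact ⟨by linarith, ENNReal.ofReal_le_ofReal (by linarith)⟩
    · rintro ⟨h0, h⟩
      rw [ENNReal.ofReal_le_ofReal_iff h0] at h
      linarith

lemma indepFun_los_interference (y : Plane) : IndepFun (S.los y) (S.interference y) μ := by
  have hm : Measurable fun z : (ℕ → Plane) × (ℕ → ℝ) => ∑' i, p.signal y (z.1 i) (z.2 i) := by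
    unfold Params.signal
    exact Measurable.tsum fun i => by fun_prop
  exact (S.indep_los y).comp measurable_id hm

variable [IsProbabilityMeasure μ]

lemma monotone_interferenceCDF : Monotone S.interferenceCDF := fun _ _ h =>
  measureReal_mono fun _ hω => ⟨hω.1.trans h, hω.2.trans (ENNReal.ofReal_le_ofReal h)⟩

lemma abs_interferenceCDF_le (T : ℝ) : |S.interferenceCDF T| ≤ 1 := by
  rw [interferenceCDF, abs_of_nonneg measureReal_nonneg]
  exact measureReal_le_one

lemma lowerCDF_le_interferenceCDF (hPd : 0 < p.Pd) (hαd : 2 < p.αd) (hlam : 0 ≤ p.lam) (T : ℝ) :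
    p.lowerCDF T ≤ S.interferenceCDF T := by
  by_cases hT : 0 < T
  · simpa [interferenceCDF, hT.le] using S.lowerCDF_le_measureReal_interference hPd hαd hlam 0 hT
  · rw [Params.lowerCDF, if_neg hT]
    exact measureReal_nonneg

lemma interferenceCDF_le_upperCDF (hPd : 0 < p.Pd) (hαd : 0 < p.αd) (hlam : 0 < p.lam) (T : ℝ) :
    S.interferenceCDF T ≤ p.upperCDF T := by
  have hpos : ∀ T, 0 < T → S.interferenceCDF T ≤ p.upperCDF T := fun T hT => by
    simpa [interferenceCDF, hT.le] using
      S.measureReal_interference_le_upperCDF hPd hαd hlam.le 0 hT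
  rcases lt_trichotomy T 0 with hT | rfl | hT
  · simp [interferenceCDF, Params.upperCDF, hT.not_ge, hT.not_gt]
  -- the interference almost surely does not vanish
  · rw [Params.upperCDF, if_neg (lt_irrefl _)]
    refine ge_of_tendsto (Params.tendsto_upperCDF_zero hPd hαd hlam) ?_
    filter_upwards [self_mem_nhdsWithin] with T hT
    exact (S.monotone_interferenceCDF (le_of_lt hT)).trans (hpos T hT)
  · exact hpos T hT

lemma measureReal_interference_eq (hlam : 0 ≤ p.lam) (y : Plane) (T : ℝ) :
    μ.real {ω | 0 ≤ T ∧ S.interference y ω ≤ ENNReal.ofReal T} = S.interferenceCDF T := by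
  by_cases hT : 0 ≤ T
  · simp only [interferenceCDF, hT, true_and, measureReal_def,
      S.measure_interference_le_eq hlam y 0 T]
  · simp [interferenceCDF, hT]

lemma measureReal_los_false (y : Plane) : μ.real {ω | S.los y ω = false} = p.pNLoS ‖y‖ := by
  have h : {ω | S.los y ω = false} = {ω | S.los y ω = true}ᶜ := by
    ext ω
    simp
  have hL : MeasurableSet {ω | S.los y ω = true} :=
    S.measurable_los y (measurableSet_singleton true)
  rw [h, probReal_compl_eq_one_sub hL, S.prob_los, Params.pNLoS]

/-- Conditioning on the state of the link from the UAV. -/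
lemma coverage_eq (hPu : 0 < p.Pu) (hη : 0 < p.η) (hh : 0 < p.h) (hlam : 0 ≤ p.lam)
    (hN : 0 ≤ p.N) {β : ℝ} (hβ : 0 < β) {r : ℝ} (hr : 0 ≤ r) (φ : ℝ) :
    S.coverage β r φ = p.pLoS r * S.interferenceCDF (p.powerLoS r / β - p.N) +
      p.pNLoS r * S.interferenceCDF (p.powerNLoS r / β - p.N) := by
  set y := polarPoint r φ with hy
  have hnorm : ‖y‖ = r := norm_polarPoint hr φ
  let A : ℝ → Set ℝ≥0∞ := fun T => {a | 0 ≤ T ∧ a ≤ ENNReal.ofReal T}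
  have hA : ∀ T, MeasurableSet (A T) := fun T =>
    (MeasurableSet.const _).inter measurableSet_Iic
  have hL : MeasurableSet {ω | S.los y ω = true} :=
    S.measurable_los y (measurableSet_singleton true)
  have hprod : ∀ (b : Bool) (T : ℝ), μ.real (S.los y ⁻¹' {b} ∩ S.interference y ⁻¹' A T) =
      μ.real {ω | S.los y ω = b} * S.interferenceCDF T := by
    intro b T
    rw [← S.measureReal_interference_eq hlam y T, measureReal_def,
      (S.indepFun_los_interference y).measure_inter_preimage_eq_mul _ _
        (measurableSet_singleton b) (hA T), ENNReal.toReal_mul]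
    rfl
  have h1 : {ω | ENNReal.ofReal β ≤ S.sinr y ω} ∩ {ω | S.los y ω = true} =
      S.los y ⁻¹' {true} ∩ S.interference y ⁻¹' A (p.powerLoS r / β - p.N) := by
    ext ω
    simp only [mem_inter_iff, mem_ofPred_eq, mem_preimage, mem_singleton_iff, sinr, received, A]
    rw [and_comm]
    refine and_congr_right fun h => ?_
    rw [if_pos h, hnorm, le_div_add_iff hβ (Params.powerLoS_pos hPu hh r) hN]
  have h2 : {ω | ENNReal.ofReal β ≤ S.sinr y ω} \ {ω | S.los y ω = true} =
      S.los y ⁻¹' {false} ∩ S.interference y ⁻¹' A (p.powerNLoS r / β - p.N) := by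
    ext ω
    simp only [Set.mem_sdiff, mem_inter_iff, mem_ofPred_eq, mem_preimage, mem_singleton_iff, sinr,
      received, A, Bool.not_eq_true]
    rw [and_comm]
    refine and_congr_right fun h => ?_
    rw [if_neg (by simp [h]), hnorm, le_div_add_iff hβ (Params.powerNLoS_pos hPu hη hh r) hN]
  rw [coverage, ← measureReal_inter_add_sdiff hL, h1, h2, hprod, hprod, S.prob_los,
    S.measureReal_los_false, hnorm]

/-- The average coverage probability is the coverage bound built from the true distribution function
of the interference. -/
lemma integrableOn_and_averageCoverage_eq (hPu : 0 < p.Pu) (hη : 0 < p.η) (hh : 0 < p.h)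
    (hC : 0 ≤ p.C) (hlam : 0 ≤ p.lam) (hN : 0 ≤ p.N) {β Rc : ℝ} (hβ : 0 < β) (hRc : 0 < Rc) :
    IntegrableOn (fun z : ℝ × ℝ => S.coverage β z.1 z.2 * userDensity Rc z.1)
      (Icc (0 : ℝ) Rc ×ˢ Icc (0 : ℝ) (2 * Real.pi)) ∧
    S.averageCoverage β Rc = p.coverageBound β Rc S.interferenceCDF := by
  have hG := S.monotone_interferenceCDF.measurable
  have hiL := Params.intervalIntegrable_integrandLoS hC hG S.abs_interferenceCDF_le β Rc
  have hiN := Params.intervalIntegrable_integrandNLoS hC hG S.abs_interferenceCDF_le β Rc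
  set f : ℝ → ℝ := fun r => p.integrandLoS β Rc S.interferenceCDF r +
    p.integrandNLoS β Rc S.interferenceCDF r with hf
  have hfint : IntegrableOn f (Icc 0 Rc) := by
    rw [integrableOn_Icc_iff_integrableOn_Ioc,
      ← intervalIntegrable_iff_integrableOn_Ioc_of_le hRc.le]
    exact hiL.add hiN
  have hmeas : MeasurableSet (Icc (0 : ℝ) Rc ×ˢ Icc (0 : ℝ) (2 * Real.pi)) :=
    measurableSet_Icc.prod measurableSet_Icc
  have heq : EqOn (fun z : ℝ × ℝ => S.coverage β z.1 z.2 * userDensity Rc z.1)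
      (fun z => f z.1 * (2 * Real.pi)⁻¹) (Icc (0 : ℝ) Rc ×ˢ Icc (0 : ℝ) (2 * Real.pi)) := by
    rintro ⟨r, φ⟩ ⟨hr, -⟩
    have hpi := Real.pi_ne_zero
    simp only [hf, S.coverage_eq hPu hη hh hlam hN hβ hr.1 φ, userDensity, Params.integrandLoS,
      Params.integrandNLoS]
    field_simp
  constructor
  · refine IntegrableOn.congr_fun ?_ heq.symm hmeas
    rw [IntegrableOn, Measure.volume_eq_prod, ← Measure.prod_restrict]
    exact hfint.mul_prod (integrable_const _)
  · rw [averageCoverage, setIntegral_congr_fun hmeas heq, Measure.volume_eq_prod,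
      setIntegral_prod_mul f (fun _ => (2 * Real.pi)⁻¹), setIntegral_const,
      integral_Icc_eq_integral_Ioc, ← intervalIntegral.integral_of_le hRc.le, hf,
      intervalIntegral.integral_add hiL hiN, Params.coverageBound, Real.volume_real_Icc_of_le
      (by positivity), sub_zero, smul_eq_mul, mul_inv_cancel₀ (by positivity), mul_one]

end Network

end UAV

theorem theorem2 {Ω : Type*} [MeasurableSpace Ω] (μ : Measure Ω) [IsProbabilityMeasure μ]
    (p : UAV.Params) (S : UAV.Network μ p)
    (hPu : 0 < p.Pu) (hαu : 0 < p.αu) (hη : 0 < p.η) (hh : 0 < p.h) (hC : 0 ≤ p.C)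
    (hPd : 0 < p.Pd) (hαd : 2 < p.αd) (hlam : 0 < p.lam) (hN : 0 ≤ p.N)
    (β Rc : ℝ) (hβ : 0 < β) (hRc : 0 < Rc) :
    -- bounds on the distribution function of the interference at every location
    (∀ (y : UAV.Plane) (T : ℝ), 0 < T →
      p.lowerCDF T ≤ μ.real {ω | S.interference y ω ≤ ENNReal.ofReal T} ∧
      μ.real {ω | S.interference y ω ≤ ENNReal.ofReal T} ≤ p.upperCDF T) ∧
    -- the average coverage probability and the integrals in the bounds are well defined
    IntegrableOn (fun z : ℝ × ℝ => S.coverage β z.1 z.2 * UAV.Network.userDensity Rc z.1)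
      (Icc (0 : ℝ) Rc ×ˢ Icc (0 : ℝ) (2 * Real.pi)) ∧
    (∀ F ∈ ({p.lowerCDF, p.upperCDF} : Set (ℝ → ℝ)),
      IntervalIntegrable (p.integrandLoS β Rc F) volume 0 Rc ∧
      IntervalIntegrable (p.integrandNLoS β Rc F) volume 0 Rc) ∧
    -- the lower and the upper bound
    p.coverageBound β Rc p.lowerCDF ≤ S.averageCoverage β Rc ∧
    S.averageCoverage β Rc ≤ p.coverageBound β Rc p.upperCDF := by

  have hα0 : 0 < p.αd := by linarith
  have hcov := S.integrableOn_and_averageCoverage_eq hPu hη hh hC hlam.le hN hβ hRc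
  have hG := S.monotone_interferenceCDF.measurable
  have hU := UAV.Params.abs_upperCDF_le hPd hα0 hlam.le
  have hL := UAV.Params.abs_lowerCDF_le hPd hαd hlam.le
  refine ⟨fun y T hT => ⟨S.lowerCDF_le_measureReal_interference hPd hαd hlam.le y hT,
    S.measureReal_interference_le_upperCDF hPd hα0 hlam.le y hT⟩, hcov.1, ?_, ?_, ?_⟩
  · rintro F (rfl | rfl)
    · exact ⟨UAV.Params.intervalIntegrable_integrandLoS hC p.measurable_lowerCDF hL β Rc,
        UAV.Params.intervalIntegrable_integrandNLoS hC p.measurable_lowerCDF hL β Rc⟩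
    · exact ⟨UAV.Params.intervalIntegrable_integrandLoS hC p.measurable_upperCDF hU β Rc,
        UAV.Params.intervalIntegrable_integrandNLoS hC p.measurable_upperCDF hU β Rc⟩
  · rw [hcov.2]
    exact UAV.Params.coverageBound_mono hC p.measurable_lowerCDF hG hL S.abs_interferenceCDF_le
      (S.lowerCDF_le_interferenceCDF hPd hαd hlam.le) β hRc.le
  · rw [hcov.2]
    exact UAV.Params.coverageBound_mono hC hG p.measurable_upperCDF S.abs_interferenceCDF_le hU
      (S.interferenceCDF_le_upperCDF hPd hα0 hlam) β hRc.le
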